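/- For $n \ge 1$ let $\mathbb{Z}_2^n = (\mathbb{Z}/2\mathbb{Z})^n$ and $N = 2^n = |\mathbb{Z}_2^n|$, and let $A \subseteq \mathbb{Z}_2^n$ be chosen uniformly at random among all $2^N$ subsets. Let $G_A$ be the Cayley sum graph of $A$, that is, the graph with vertex set $\mathbb{Z}_2^n$ in which two distinct vertices $i, j$ are adjacent if and only if $i + j \in A$, and let $\omega(G_A)$ denote its clique number. Write $\log$ for the logarithm to base $2$. Then there are absolute constants $C_1, C_2 > 0$, and one may take $C_1 = \frac14$ and $C_2 = 308$, such that $$\lim_{n \to \infty} \mathbb{P}\bigl(C_1 \log N \log\log N \;\le\; \omega(G_A) \;\le\; C_2 \log N \log\log N\bigr) = 1.$$ In particular the clique number is almost surely not $O(\log N)$: for every constant $C$, $$\lim_{n \to \infty} \mathbb{P}\bigl(\omega(G_A) \le C \log N\bigr) = 0.$$ -/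

import Mathlib

open Filter Topology

/-- The Cayley sum graph `G_A` of a subset `A` of an abelian group `Γ`: its vertex set is `Γ`, and
distinct elements `i`, `j` are joined precisely when `i + j ∈ A`. -/
def cayleySumGraph {Γ : Type*} [AddCommGroup Γ] (A : Set Γ) : SimpleGraph Γ where
  Adj i j := i ≠ j ∧ i + j ∈ A
  symm := ⟨fun i j h => ⟨h.1.symm, by rw [add_comm]; exact h.2⟩⟩
  loopless := ⟨fun _ h => h.1 rfl⟩

/-- The law of the random Cayley sum graph on a finite abelian group `Γ`: the law of `G_A`, where
`A` is chosen uniformly at random among all subsets of `Γ`. -/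
noncomputable def randomCayleySumGraph (Γ : Type*) [AddCommGroup Γ] [Fintype Γ] :
    PMF (SimpleGraph Γ) :=
  (PMF.uniformOfFintype (Finset Γ)).map (fun A : Finset Γ => cayleySumGraph (A : Set Γ))

/-- The probability that the random Cayley sum graph on `Γ` satisfies the property `E`. -/
noncomputable def cayleySumProb (Γ : Type*) [AddCommGroup Γ] [Fintype Γ]
    (E : SimpleGraph Γ → Prop) : ENNReal :=
  (randomCayleySumGraph Γ).toOuterMeasure {G | E G}

/-! Write l = log₂ n; the claimed order of the clique number is n·l. A nonempty X is a clique
exactly when A contains the nonzero part of X + X, which happens with probability 2^(1 - |X + X|).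
Sets with small sumset, such as subspaces, are therefore much likelier cliques than typical sets,
and this produces the extra factor l.

Upper bound. Let m exceed 308·n·l slightly. A union bound over all m-sets is too expensive, so X is
encoded according to M = |X + X|. By `exists_structure`, X has rank at most 6M/m + 4 log₂ m and
contains sets T and S with X ⊆ T + S + S, |T| ≤ 2M/m, |S| = O(√(M log m)) and |S + S| ≥ 3m/4. If M ≤
30·m·l, only S + S ⊆ A ∪ {0} is kept: the rank is O(l), S is described by fewer than 3m/4 bits, and
the union bound wins. If M is larger, X itself is described by picking its elements from T + S + S;
this costs about 3m log₂ m further bits, which is small compared with M.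

The rank bound is a Freiman-type statement over 𝔽₂: a maximal T covers half of each translate x + X,
and adjoining few vectors to its span captures a quarter of X, after which few cosets remain
(`exists_span_of_half_covering`). The set S is a random sample of X that realises prescribed popular
sums (`exists_subset_add_superset`).

Lower bound. The second moment method is applied to graphs of linear maps 𝔽₂^k → 𝔽₂^(n-k), with 2^k
between n·l/4 and n·l/2. Two graphs meet in 2^j points, j the dimension of the kernel of the
difference; the proportion of maps with such a kernel is at most 2^(kj - (n-k)j), which outweighs
the correlation 2^(2^j) for every j between 1 and k. The failure of O(log N) follows, since l is
unbounded. -/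

/-! ### Counting subsets: union bounds and the second moment -/

section Density

variable {Γ : Type*} [Fintype Γ]

open scoped Classical in
/-- The proportion of the subsets of `Γ` that have the property `E`. -/
noncomputable def subsetDensity (E : Finset Γ → Prop) : ℝ :=
  ((Finset.univ.filter E).card : ℝ) / 2 ^ Fintype.card Γ

theorem subsetDensity_eq (E : Finset Γ → Prop) [DecidablePred E] :
    subsetDensity E = ((Finset.univ.filter E).card : ℝ) / 2 ^ Fintype.card Γ := by
  unfold subsetDensity
  congr!

theorem subsetDensity_nonneg (E : Finset Γ → Prop) : 0 ≤ subsetDensity E := by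
  unfold subsetDensity; positivity

theorem subsetDensity_mono {E F : Finset Γ → Prop} (h : ∀ A, E A → F A) :
    subsetDensity E ≤ subsetDensity F := by
  classical
  simp only [subsetDensity_eq]
  gcongr
  exact h _

theorem subsetDensity_or_le (E F : Finset Γ → Prop) :
    subsetDensity (fun A => E A ∨ F A) ≤ subsetDensity E + subsetDensity F := by
  classical
  simp only [subsetDensity_eq]
  rw [← add_div, Finset.filter_or]
  gcongr
  exact_mod_cast Finset.card_union_le _ _

theorem subsetDensity_exists_le {ι : Type*} (s : Finset ι) (E : ι → Finset Γ → Prop) :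
    subsetDensity (fun A => ∃ i ∈ s, E i A) ≤ ∑ i ∈ s, subsetDensity (E i) := by
  classical
  simp only [subsetDensity_eq]
  rw [← Finset.sum_div]
  gcongr
  have : (Finset.univ.filter fun A : Finset Γ => ∃ i ∈ s, E i A)
      ⊆ s.biUnion fun i => Finset.univ.filter (E i) := by
    intro A; simp
  exact_mod_cast (Finset.card_le_card this).trans Finset.card_biUnion_le

theorem subsetDensity_add_not (E : Finset Γ → Prop) :
    subsetDensity E + subsetDensity (fun A => ¬ E A) = 1 := by
  classical
  simp only [subsetDensity_eq]
  rw [← add_div, div_eq_one_iff_eq (by positivity)]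
  have := Finset.card_filter_add_card_filter_not (s := (Finset.univ : Finset (Finset Γ))) E
  rw [Finset.card_univ, Fintype.card_finset] at this
  exact_mod_cast this

theorem subsetDensity_superset (D : Finset Γ) :
    subsetDensity (fun A => D ⊆ A) = ((2 : ℝ) ^ D.card)⁻¹ := by
  classical
  simp only [subsetDensity_eq]
  have h : (Finset.univ.filter fun A : Finset Γ => D ⊆ A) = Finset.Icc D Finset.univ := by
    ext A; simp
  rw [h, Finset.card_Icc_finset (Finset.subset_univ _), Finset.card_univ]
  have hD : D.card ≤ Fintype.card Γ := Finset.card_le_univ D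
  rw [Nat.cast_pow, Nat.cast_ofNat, div_eq_iff (by positivity), inv_mul_eq_div,
    eq_div_iff (by positivity), ← pow_add, Nat.sub_add_cancel hD]

/-- The union bound over a finite family of parameters `ω`, for the events that `A` contains a set
`D ω` with at least `c` elements. -/
theorem subsetDensity_exists_superset_le {Ω : Type*} [Fintype Ω] (D : Ω → Finset Γ) (c : ℕ) :
    subsetDensity (fun A => ∃ ω, c ≤ (D ω).card ∧ D ω ⊆ A)
      ≤ Fintype.card Ω * ((2 : ℝ) ^ c)⁻¹ := by
  classical
  calc subsetDensity (fun A => ∃ ω, c ≤ (D ω).card ∧ D ω ⊆ A)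
      ≤ subsetDensity (fun A => ∃ ω ∈ (Finset.univ : Finset Ω), c ≤ (D ω).card ∧ D ω ⊆ A) :=
        subsetDensity_mono fun A ⟨ω, h⟩ => ⟨ω, Finset.mem_univ _, h⟩
    _ ≤ ∑ ω : Ω, subsetDensity (fun A => c ≤ (D ω).card ∧ D ω ⊆ A) :=
        subsetDensity_exists_le _ _
    _ ≤ ∑ _ω : Ω, ((2 : ℝ) ^ c)⁻¹ := by
        refine Finset.sum_le_sum fun ω _ => ?_
        by_cases h : c ≤ (D ω).card
        · refine (subsetDensity_mono fun A hA => hA.2).trans ?_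
          rw [subsetDensity_superset]
          gcongr
          norm_num
        · have : subsetDensity (fun A => c ≤ (D ω).card ∧ D ω ⊆ A) = 0 := by
            simp [subsetDensity, h]
          rw [this]; positivity
    _ = _ := by simp

/-- The second moment method: if the sets `D i` all have `c` elements and few pairs of them
overlap much, then most sets `A` contain one of them. -/
theorem subsetDensity_forall_not_superset_le {ι : Type*} [Fintype ι] [Nonempty ι] [DecidableEq Γ]
    (D : ι → Finset Γ) (c : ℕ) (hc : ∀ i, (D i).card = c) :
    subsetDensity (fun A => ∀ i, ¬ D i ⊆ A)
      ≤ (∑ i, ∑ j, ((2 : ℝ) ^ (D i ∩ D j).card - 1)) / (Fintype.card ι : ℝ) ^ 2 := by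
  classical
  set N : ℝ := 2 ^ Fintype.card Γ with hN
  have hNpos : 0 < N := by positivity
  set a : ℝ := ((2 : ℝ) ^ c)⁻¹ with ha
  have hapos : 0 < a := by positivity
  set I : ℝ := (Fintype.card ι : ℝ) with hI
  have hIpos : 0 < I := by rw [hI]; exact_mod_cast Fintype.card_pos
  let χ : ι → Finset Γ → ℝ := fun i A => if D i ⊆ A then 1 else 0
  have hsum : ∀ E : Finset Γ, ∑ A : Finset Γ, (if E ⊆ A then (1 : ℝ) else 0)
      = N * ((2 : ℝ) ^ E.card)⁻¹ := by
    intro E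
    rw [Finset.sum_boole, ← subsetDensity_superset, subsetDensity_eq, mul_div_cancel₀ _ hNpos.ne']
  have h1 : ∑ A : Finset Γ, ∑ i, χ i A = N * (I * a) := by
    rw [Finset.sum_comm]
    simp only [χ, hsum, hc]
    simp [← ha]; ring
  have h2 : ∑ A : Finset Γ, (∑ i, χ i A) ^ 2
      = N * a ^ 2 * ∑ i, ∑ j, (2 : ℝ) ^ (D i ∩ D j).card := by
    have : ∀ A : Finset Γ, (∑ i, χ i A) ^ 2 = ∑ i, ∑ j, if D i ∪ D j ⊆ A then (1 : ℝ) else 0 := by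
      intro A
      rw [sq, Finset.sum_mul_sum]
      refine Finset.sum_congr rfl fun i _ => Finset.sum_congr rfl fun j _ => ?_
      simp only [χ, Finset.union_subset_iff]
      by_cases h : D i ⊆ A <;> by_cases h' : D j ⊆ A <;> simp [h, h']
    simp only [this]
    rw [Finset.sum_comm, Finset.mul_sum]
    refine Finset.sum_congr rfl fun i _ => ?_
    rw [Finset.sum_comm, Finset.mul_sum]
    refine Finset.sum_congr rfl fun j _ => ?_
    rw [hsum, mul_assoc]
    congr 1
    -- Since |D i ∪ D j| = 2c - |D i ∩ D j|, the joint probability is `a ^ 2` times 2^|D i ∩ D j|.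
    have h3 := Finset.card_union_add_card_inter (D i) (D j)
    rw [hc, hc] at h3
    rw [ha, inv_eq_iff_eq_inv, mul_inv, ← inv_pow, inv_inv, ← div_eq_mul_inv,
      eq_div_iff (by positivity), ← pow_add, h3, ← pow_mul, mul_two]
  -- Chebyshev: where no `D i` is contained in `A`, the count deviates from its mean `I * a` by the
  -- whole mean.
  have h4 : ((Finset.univ.filter fun A : Finset Γ => ∀ i, ¬ D i ⊆ A).card : ℝ) * (I * a) ^ 2
      ≤ ∑ A : Finset Γ, (∑ i, χ i A - I * a) ^ 2 := by
    rw [← nsmul_eq_mul, ← Finset.sum_const]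
    calc _ = ∑ A ∈ Finset.univ.filter fun A : Finset Γ => ∀ i, ¬ D i ⊆ A,
            (∑ i, χ i A - I * a) ^ 2 := by
          refine Finset.sum_congr rfl fun A hA => ?_
          have : ∑ i, χ i A = 0 :=
            Finset.sum_eq_zero fun i _ => if_neg ((Finset.mem_filter.1 hA).2 i)
          rw [this]; ring
      _ ≤ _ := Finset.sum_le_sum_of_subset_of_nonneg (Finset.filter_subset _ _)
          fun _ _ _ => sq_nonneg _
  have h5 : ∑ A : Finset Γ, (∑ i, χ i A - I * a) ^ 2
      = N * a ^ 2 * (∑ i, ∑ j, (2 : ℝ) ^ (D i ∩ D j).card) - N * (I * a) ^ 2 := by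
    simp only [sub_sq, Finset.sum_add_distrib, Finset.sum_sub_distrib, h2]
    rw [← Finset.sum_mul, ← Finset.mul_sum, h1]
    simp only [Finset.sum_const, Finset.card_univ, Fintype.card_finset, nsmul_eq_mul]
    push_cast
    rw [← hN]; ring
  have h6 : ∑ i, ∑ j, ((2 : ℝ) ^ (D i ∩ D j).card - 1)
      = (∑ i, ∑ j, (2 : ℝ) ^ (D i ∩ D j).card) - I ^ 2 := by
    simp [Finset.sum_sub_distrib, hI, sq]
  rw [subsetDensity_eq, div_le_div_iff₀ hNpos (by positivity), h6]
  rw [h5] at h4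
  have : 0 < a ^ 2 := by positivity
  nlinarith [h4]

end Density

theorem cayleySumProb_eq_ofReal {Γ : Type*} [AddCommGroup Γ] [Fintype Γ]
    (E : SimpleGraph Γ → Prop) :
    cayleySumProb Γ E
      = ENNReal.ofReal (subsetDensity fun A : Finset Γ => E (cayleySumGraph (A : Set Γ))) := by
  classical
  unfold cayleySumProb randomCayleySumGraph
  rw [subsetDensity_eq, PMF.toOuterMeasure_map_apply, PMF.toOuterMeasure_uniformOfFintype_apply,
    ENNReal.ofReal_div_of_pos (by positivity), Fintype.card_subtype, Fintype.card_finset]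
  congr 1
  · rw [ENNReal.ofReal_natCast]; rfl
  · rw [ENNReal.ofReal_pow (by norm_num)]; simp

/-! ### Rank of sets with small doubling over 𝔽₂ -/

section SmallDoubling

set_option linter.unusedSectionVars false

open scoped Pointwise

variable {V : Type*} [AddCommGroup V] [Module (ZMod 2) V] [DecidableEq V]

/-- A covering lemma in the style of Ruzsa. -/
theorem exists_subset_half_covering (X : Finset V) :
    ∃ T ⊆ X, T.card * X.card ≤ 2 * (T + X).card ∧
      ∀ x ∈ X, X.card ≤ 2 * (X.filter fun y => x + y ∈ T + X).card := by
  -- `T` is a largest subset whose elements contribute on average at least |X|/2 sums to T + X. If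
  -- more than half of x + X missed T + X, then `insert x T` would still qualify.
  obtain ⟨T, hT, hmax⟩ := Finset.exists_max_image
    (X.powerset.filter fun T => T.card * X.card ≤ 2 * (T + X).card) Finset.card ⟨∅, by simp⟩
  rw [Finset.mem_filter, Finset.mem_powerset] at hT
  refine ⟨T, hT.1, hT.2, fun x hx => ?_⟩
  by_cases hxT : x ∈ T
  · rw [Finset.filter_true_of_mem fun y hy => Finset.add_mem_add hxT hy]
    omega
  by_contra! hlt
  have hnot : ¬ ((insert x T).card * X.card ≤ 2 * (insert x T + X).card) := fun h => by
    have := hmax (insert x T) (by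
      rw [Finset.mem_filter, Finset.mem_powerset]
      exact ⟨Finset.insert_subset hx hT.1, h⟩)
    rw [Finset.card_insert_of_notMem hxT] at this
    omega
  rw [Finset.card_insert_of_notMem hxT] at hnot
  have hsplit := Finset.card_filter_add_card_filter_not (s := X) (fun y => x + y ∈ T + X)
  have hsub : (T + X) ∪ ((X.filter fun y => ¬ x + y ∈ T + X).image (x + ·)) ⊆ insert x T + X := by
    refine Finset.union_subset (Finset.add_subset_add_right (Finset.subset_insert _ _)) ?_
    intro z hz
    obtain ⟨y, hy, rfl⟩ := Finset.mem_image.1 hz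
    exact Finset.add_mem_add (Finset.mem_insert_self _ _) (Finset.mem_filter.1 hy).1
  have hdisj : Disjoint (T + X) ((X.filter fun y => ¬ x + y ∈ T + X).image (x + ·)) := by
    rw [Finset.disjoint_right]
    intro z hz
    obtain ⟨y, hy, rfl⟩ := Finset.mem_image.1 hz
    exact (Finset.mem_filter.1 hy).2
  have hcard := Finset.card_le_card hsub
  rw [Finset.card_union_of_disjoint hdisj,
    Finset.card_image_of_injective _ (add_right_injective x)] at hcard
  have := hT.2
  rw [add_mul] at hnot
  omega

/-- The number of cosets of `W` that meet `X`. -/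
noncomputable def cosetCount (W : Submodule (ZMod 2) V) (X : Finset V) : ℕ :=
  (W.mkQ '' (X : Set V)).ncard

theorem cosetCount_le_card (W : Submodule (ZMod 2) V) (X : Finset V) :
    cosetCount W X ≤ X.card := by
  unfold cosetCount
  simpa using Set.ncard_image_le (f := W.mkQ) X.finite_toSet

/-- If `X` is in most directions of `X` closed under addition modulo `W`, then either `W` already
contains a quarter of `X`, or some extension of `W` by one vector swallows a positive proportion of
the cosets that meet `X`. -/
theorem exists_cosetCount_sup_le {W : Submodule (ZMod 2) V} {X : Finset V}
    [DecidablePred (· ∈ W)] [DecidableEq (V ⧸ W)]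
    (hX : X.Nonempty)
    (hW : ∀ x ∈ X, X.card ≤ 2 * (X.filter fun y => W.mkQ (x + y) ∈ X.image W.mkQ).card)
    (hlt : 4 * (X.filter (· ∈ W)).card < X.card) :
    ∃ y ∈ X, 6 * cosetCount (W ⊔ Submodule.span (ZMod 2) {y}) X ≤ 5 * cosetCount W X := by
  classical
  set m := X.card
  set Q := X.image W.mkQ with hQ
  have hQcard : cosetCount W X = Q.card := by
    rw [cosetCount, hQ, ← Set.ncard_coe_finset, Finset.coe_image]
  set X' := X.filter (¬ · ∈ W) with hX'
  have hX'card : (X.filter (· ∈ W)).card + X'.card = m :=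
    Finset.card_filter_add_card_filter_not _
  have hrow : ∀ ξ ∈ Q, X.card ≤ 2 * (X.filter (· ∈ W)).card
      + 2 * (X'.filter fun y => ξ + W.mkQ y ∈ Q).card := by
    intro ξ hξ
    obtain ⟨x, hx, rfl⟩ := Finset.mem_image.1 hξ
    have h1 := hW x hx
    have h2 : (X.filter fun y => W.mkQ (x + y) ∈ Q) ⊆
        X.filter (· ∈ W) ∪ X'.filter fun y => W.mkQ x + W.mkQ y ∈ Q := by
      intro y hy
      rw [Finset.mem_filter, map_add] at hy
      by_cases hyW : y ∈ W
      · exact Finset.mem_union_left _ (Finset.mem_filter.2 ⟨hy.1, hyW⟩)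
      · exact Finset.mem_union_right _
          (Finset.mem_filter.2 ⟨Finset.mem_filter.2 ⟨hy.1, hyW⟩, hy.2⟩)
    have h3 := (Finset.card_le_card h2).trans (Finset.card_union_le _ _)
    omega
  -- Double counting of pairs (ξ, y): if every `y` outside `W` were good for fewer than a third of
  -- `Q`, then 3m ≤ 6w + 2(m - w) with w = |X ∩ W|, that is m ≤ 4w, against `hlt`.
  obtain ⟨y, hy, hygood⟩ : ∃ y ∈ X', Q.card ≤ 3 * (Q.filter fun ξ => ξ + W.mkQ y ∈ Q).card := by
    by_contra! hcon
    have h1 : ∑ ξ ∈ Q, (X'.filter fun y => ξ + W.mkQ y ∈ Q).card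
        = ∑ y ∈ X', (Q.filter fun ξ => ξ + W.mkQ y ∈ Q).card := by
      simp only [Finset.card_filter]
      exact Finset.sum_comm
    have h2 : Q.card * m ≤ Q.card * (2 * (X.filter (· ∈ W)).card)
        + 2 * ∑ ξ ∈ Q, (X'.filter fun y => ξ + W.mkQ y ∈ Q).card := by
      have := Finset.sum_le_sum hrow
      rw [Finset.sum_add_distrib, Finset.sum_const, Finset.sum_const, ← Finset.mul_sum] at this
      simpa only [smul_eq_mul] using this
    have h3 : 3 * ∑ y ∈ X', (Q.filter fun ξ => ξ + W.mkQ y ∈ Q).card ≤ X'.card * Q.card := by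
      rw [Finset.mul_sum, ← smul_eq_mul, ← Finset.sum_const]
      exact Finset.sum_le_sum fun y hy => (hcon y hy).le
    have hQpos : 0 < Q.card := (hX.image _).card_pos
    rw [h1] at h2
    nlinarith
  refine ⟨y, (Finset.mem_filter.1 hy).1, ?_⟩
  have hyW : y ∉ W := (Finset.mem_filter.1 hy).2
  set W' := W ⊔ Submodule.span (ZMod 2) {y} with hW'
  have hle : W ≤ W' := le_sup_left
  set π := Submodule.factor hle with hπ
  have hcount : cosetCount W' X = (Q.image π).card := by
    rw [cosetCount, ← Set.ncard_coe_finset, Finset.coe_image, hQ, Finset.coe_image, Set.image_image]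
    rfl
  set P := Q.filter fun ξ => ξ + W.mkQ y ∈ Q with hP
  have hη : W.mkQ y ≠ 0 := by
    rw [Ne, Submodule.mkQ_apply, Submodule.Quotient.mk_eq_zero]; exact hyW
  have hπη : π (W.mkQ y) = 0 := by
    change W'.mkQ y = 0
    rw [Submodule.mkQ_apply, Submodule.Quotient.mk_eq_zero]
    exact Submodule.mem_sup_right (Submodule.mem_span_singleton_self y)
  -- In characteristic 2 translation by `y` is a fixed-point-free involution of `P`, and `π`
  -- identifies its orbits. So the image of `Q` has at most |Q| - |P|/2 ≤ 5|Q|/6 elements.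
  have hPim : 2 * (P.image π).card ≤ P.card := by
    rw [mul_comm]
    refine (Finset.mul_card_image_le_card P 2 ?_ : _ ) |>.trans' (by rw [mul_comm])
    intro ζ hζ
    obtain ⟨ξ, hξ, rfl⟩ := Finset.mem_image.1 hζ
    have hξ' := Finset.mem_filter.1 hξ
    have : ({ξ, ξ + W.mkQ y} : Finset _) ⊆ P.filter fun a => π a = π ξ := by
      intro a ha
      rw [Finset.mem_insert, Finset.mem_singleton] at ha
      rcases ha with rfl | rfl
      · exact Finset.mem_filter.2 ⟨hξ, rfl⟩
      · refine Finset.mem_filter.2 ⟨Finset.mem_filter.2 ⟨hξ'.2, ?_⟩, by rw [map_add, hπη, add_zero]⟩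
        rw [add_assoc, ← map_add, ZModModule.add_self, map_zero, add_zero]
        exact hξ'.1
    refine le_trans ?_ (Finset.card_le_card this)
    rw [Finset.card_pair]
    simpa using hη
  have hPle := Finset.card_filter_add_card_filter_not (s := Q) (fun ξ => ξ + W.mkQ y ∈ Q)
  change P.card + _ = _ at hPle
  have hun : (Q.image π).card
      ≤ (P.image π).card + (Q.filter fun ξ => ¬ ξ + W.mkQ y ∈ Q).card := by
    rw [← Finset.filter_union_filter_not_eq (fun ξ => ξ + W.mkQ y ∈ Q) Q, Finset.image_union]
    refine (Finset.card_union_le _ _).trans ?_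
    rw [Finset.filter_union_filter_not_eq]
    gcongr
    exact Finset.card_image_le
  rw [hcount, hQcard]
  omega

/-- Iterates `exists_cosetCount_sup_le`: each adjoined vector multiplies the coset count by at most
5/6, and the count never drops below 1. The covering hypothesis survives because it only weakens as
`W` grows. -/
theorem exists_span_sup_quarter (X : Finset V) (hX : X.Nonempty) (k : ℕ) :
    ∀ W : Submodule (ZMod 2) V, cosetCount W X ≤ k →
    (∀ x ∈ X, X.card ≤ 2 * {y ∈ (X : Set V) | ∃ x' ∈ X, x + y + x' ∈ W}.ncard) →
    ∃ Y : Finset V, ((6 / 5 : ℝ)) ^ Y.card ≤ cosetCount W X ∧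
      X.card ≤ 4 * {x ∈ (X : Set V) | x ∈ W ⊔ Submodule.span (ZMod 2) (Y : Set V)}.ncard := by
  classical
  have hpos : ∀ W : Submodule (ZMod 2) V, 1 ≤ cosetCount W X := fun W =>
    Set.ncard_pos ((X.finite_toSet).image _) |>.2 ((Finset.coe_nonempty.2 hX).image _)
  induction k with
  | zero => intro W h; have := hpos W; omega
  | succ k ih =>
    intro W hk hW
    have hmem : ∀ a b : V, W.mkQ a = W.mkQ b ↔ a + b ∈ W := fun a b => by
      rw [Submodule.mkQ_apply, Submodule.mkQ_apply, Submodule.Quotient.eq, ZModModule.sub_eq_add]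
    by_cases hq : X.card ≤ 4 * {x ∈ (X : Set V) | x ∈ W}.ncard
    · exact ⟨∅, by simpa using hpos W, by simpa using hq⟩
    have hconv : ∀ p : V → Prop, {x ∈ (X : Set V) | p x}.ncard = (X.filter p).card := fun p => by
      rw [← Set.ncard_coe_finset, Finset.coe_filter]; rfl
    obtain ⟨y, hy, hstep⟩ := exists_cosetCount_sup_le (W := W) hX (fun x hx => by
      refine (hW x hx).trans ?_
      rw [hconv]
      gcongr with z hz
      rintro ⟨x', hx', h⟩
      exact Finset.mem_image.2 ⟨x', hx', ((hmem _ _).2 h).symm⟩) (by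
      rw [hconv fun x => x ∈ W, not_le] at hq
      exact hq)
    obtain ⟨Y, hY1, hY2⟩ := ih (W ⊔ Submodule.span (ZMod 2) {y})
      (by have := hpos W; omega)
      (fun x hx => (hW x hx).trans (by
        refine Nat.mul_le_mul_left _ (Set.ncard_le_ncard ?_ (X.finite_toSet.subset fun _ h => h.1))
        rintro z ⟨hz, x', hx', h⟩
        exact ⟨hz, x', hx', Submodule.mem_sup_left h⟩))
    refine ⟨insert y Y, ?_, ?_⟩
    · have h1 : ((6 / 5 : ℝ)) ^ (insert y Y).card ≤ (6 / 5 : ℝ) ^ (Y.card + 1) :=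
        pow_le_pow_right₀ (by norm_num) (Finset.card_insert_le _ _)
      have h2 : (6 : ℝ) * cosetCount (W ⊔ Submodule.span (ZMod 2) {y}) X ≤ 5 * cosetCount W X := by
        exact_mod_cast hstep
      rw [pow_succ] at h1
      linarith
    · rw [Finset.coe_insert, Submodule.span_insert, ← sup_assoc]
      exact hY2

/-- `Z` takes one representative from each coset meeting `X`; the sums z + w with w ∈ X ∩ W are then
pairwise distinct. Once `W` holds a positive proportion of `X`, few cosets are left. -/
theorem cosetCount_mul_card_le (W : Submodule (ZMod 2) V) [DecidablePred (· ∈ W)] (X : Finset V) :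
    ∃ Z ⊆ X, (∀ x ∈ X, ∃ z ∈ Z, x + z ∈ W) ∧
      Z.card * (X.filter (· ∈ W)).card ≤ (X + X).card := by
  classical
  obtain ⟨Z, hZX, hZ⟩ : ∃ Z ⊆ X, Z.image W.mkQ = X.image W.mkQ ∧ Set.InjOn W.mkQ Z := by
    obtain ⟨Z, hZ1, hZ2, hZ3⟩ := Finset.exists_subset_injOn_image_eq_of_surjOn
      (f := W.mkQ) X (X.image W.mkQ) (by simp [Set.SurjOn])
    exact ⟨Z, hZ1, hZ3, hZ2⟩
  have hmem : ∀ a b : V, W.mkQ a = W.mkQ b ↔ a + b ∈ W := fun a b => by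
    rw [Submodule.mkQ_apply, Submodule.mkQ_apply, Submodule.Quotient.eq, ZModModule.sub_eq_add]
  refine ⟨Z, hZX, fun x hx => ?_, ?_⟩
  · have : W.mkQ x ∈ Z.image W.mkQ := hZ.1 ▸ Finset.mem_image_of_mem _ hx
    obtain ⟨z, hz, h⟩ := Finset.mem_image.1 this
    exact ⟨z, hz, (hmem _ _).1 h.symm⟩
  · rw [← Finset.card_product]
    refine Finset.card_le_card_of_injOn (fun p => p.1 + p.2) ?_ ?_
    · rintro ⟨a, b⟩ h
      have h := Finset.mem_product.1 h
      exact Finset.add_mem_add (hZX h.1) (Finset.mem_filter.1 h.2).1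
    · rintro ⟨a, b⟩ h ⟨a', b'⟩ h' heq
      have h := Finset.mem_product.1 h
      have h' := Finset.mem_product.1 h'
      have hb := (Finset.mem_filter.1 h.2).2
      have hb' := (Finset.mem_filter.1 h'.2).2
      simp only at heq hb hb'
      have : a = a' := by
        refine hZ.2 h.1 h'.1 ((hmem _ _).2 ?_)
        have h1 : a + a' = b + b' := by
          rw [← ZModModule.sub_eq_add a, add_comm b b',
            ← ZModModule.sub_eq_add b', sub_eq_sub_iff_add_eq_add, heq, add_comm]
        rw [h1]
        exact W.add_mem hb hb'
      subst this
      simpa using heq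

/-- A form of Freiman's theorem over `𝔽₂`: the rank of a set with doubling constant `K` is at most
`6 K + O(log |X|)`. -/
theorem exists_span_of_half_covering {X T : Finset V} (hX : X.Nonempty)
    (hT : ∀ x ∈ X, X.card ≤ 2 * (X.filter fun y => x + y ∈ T + X).card) :
    ∃ Y : Finset V, ∃ b c : ℕ, (X : Set V) ⊆ Submodule.span (ZMod 2) (Y : Set V) ∧
      Y.card ≤ T.card + b + c ∧ 2 ^ b ≤ X.card ^ 4 ∧ c * X.card ≤ 4 * (X + X).card := by
  classical
  set W := Submodule.span (ZMod 2) (T : Set V) with hWdef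
  obtain ⟨Y, hY1, hY2⟩ := exists_span_sup_quarter X hX _ W le_rfl (fun x hx => by
    refine (hT x hx).trans ?_
    rw [← Set.ncard_coe_finset, Finset.coe_filter]
    refine Nat.mul_le_mul_left _ (Set.ncard_le_ncard ?_ (X.finite_toSet.subset fun _ h => h.1))
    rintro y ⟨hy, h⟩
    obtain ⟨t, ht, x', hx', h⟩ := Finset.mem_add.1 h
    refine ⟨hy, x', hx', ?_⟩
    rw [← h, add_assoc, ZModModule.add_self, add_zero]
    exact Submodule.subset_span ht)
  set W' := W ⊔ Submodule.span (ZMod 2) (Y : Set V) with hW'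
  obtain ⟨Z, hZX, hZ, hZc⟩ := cosetCount_mul_card_le W' X
  refine ⟨T ∪ Y ∪ Z, Y.card, Z.card, ?_, ?_, ?_, ?_⟩
  · intro x hx
    obtain ⟨z, hz, h⟩ := hZ x hx
    rw [Finset.coe_union, Finset.coe_union, Submodule.span_union, Submodule.span_union]
    have : x = (x + z) + z := by rw [add_assoc, ZModModule.add_self, add_zero]
    rw [this]
    exact Submodule.add_mem _ (Submodule.mem_sup_left h)
      (Submodule.mem_sup_right (Submodule.subset_span hz))
  · refine (Finset.card_union_le _ _).trans ?_
    gcongr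
    exact Finset.card_union_le _ _
  · have h1 : ((6 / 5 : ℝ)) ^ Y.card ≤ X.card :=
      hY1.trans (by exact_mod_cast cosetCount_le_card W X)
    have h2 : (2 : ℝ) ^ Y.card ≤ (X.card : ℝ) ^ 4 := by
      -- The exponent 4 is the least with (6/5)^4 ≥ 2; it becomes the 4 log₂ |X| in the rank bound.
      calc (2 : ℝ) ^ Y.card ≤ ((6 / 5 : ℝ) ^ 4) ^ Y.card := by gcongr; norm_num
        _ = ((6 / 5 : ℝ) ^ Y.card) ^ 4 := by rw [← pow_mul, ← pow_mul, mul_comm]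
        _ ≤ _ := by gcongr
    exact_mod_cast h2
  · have h1 : {x ∈ (X : Set V) | x ∈ W'}.ncard = (X.filter (· ∈ W')).card := by
      rw [← Set.ncard_coe_finset, Finset.coe_filter]; rfl
    rw [h1] at hY2
    nlinarith

end SmallDoubling

/-! ### Popular sums and random sampling -/

section Sampling

open scoped Pointwise

set_option linter.unusedSectionVars false

variable {V : Type*} [AddCommGroup V] [Module (ZMod 2) V] [DecidableEq V]

/-- The number of ways to write `z` as a sum of two elements of `X`. -/
def sumReps (X : Finset V) (z : V) : ℕ := (X.filter fun y => y + z ∈ X).card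

theorem sumReps_le_card (X : Finset V) (z : V) : sumReps X z ≤ X.card :=
  Finset.card_filter_le _ _

theorem mem_add_of_sumReps_pos {X : Finset V} {z : V} (h : 0 < sumReps X z) : z ∈ X + X := by
  obtain ⟨y, hy⟩ := Finset.card_pos.1 h
  rw [Finset.mem_filter] at hy
  refine Finset.mem_add.2 ⟨y, hy.1, y + z, hy.2, ?_⟩
  rw [← add_assoc, ZModModule.add_self, zero_add]

theorem sum_sumReps (X : Finset V) : ∑ z ∈ X + X, sumReps X z = X.card ^ 2 := by
  have h : ∀ z, sumReps X z = ((X ×ˢ X).filter fun p => p.1 + p.2 = z).card := by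
    intro z
    refine Finset.card_bij (fun y _ => (y, y + z)) ?_ ?_ ?_
    · intro y hy
      rw [Finset.mem_filter] at hy
      rw [Finset.mem_filter, Finset.mem_product]
      refine ⟨hy, ?_⟩
      simp only
      rw [← add_assoc, ZModModule.add_self, zero_add]
    · intro a _ b _ hab
      exact congrArg Prod.fst hab
    · rintro ⟨a, b⟩ hab
      rw [Finset.mem_filter, Finset.mem_product] at hab
      obtain ⟨⟨ha, hb⟩, rfl⟩ := hab
      have : a + (a + b) = b := by rw [← add_assoc, ZModModule.add_self, zero_add]
      refine ⟨a, Finset.mem_filter.2 ⟨ha, ?_⟩, ?_⟩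
      · simpa only [this] using hb
      · simp only [this]
  simp only [h]
  rw [← Finset.card_eq_sum_card_fiberwise, Finset.card_product, sq]
  rintro ⟨a, b⟩ hab
  have hab := Finset.mem_product.1 hab
  exact Finset.add_mem_add hab.1 hab.2

/-- At least `3 |X| / 4` elements have at least a quarter of the average number of
representations. -/
theorem three_mul_card_le_popular (X : Finset V) (hX : X.Nonempty) :
    3 * X.card ≤
      4 * ((X + X).filter fun z => X.card ^ 2 ≤ 4 * (X + X).card * sumReps X z).card := by
  set m := X.card
  set M := (X + X).card
  have hm : 0 < m := hX.card_pos
  have hM : 0 < M := (hX.add hX).card_pos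
  have h1 := Finset.sum_filter_add_sum_filter_not (X + X)
    (fun z => m ^ 2 ≤ 4 * M * sumReps X z) (sumReps X)
  rw [sum_sumReps] at h1
  set P := (X + X).filter fun z => m ^ 2 ≤ 4 * M * sumReps X z
  set P' := (X + X).filter fun z => ¬ m ^ 2 ≤ 4 * M * sumReps X z with hP'
  -- Unpopular sums carry at most a quarter of the m² pairs, and each popular sum at most m of them,
  -- so at least 3m/4 sums are popular.
  have h2 : ∑ z ∈ P, sumReps X z ≤ P.card * m := by
    rw [← smul_eq_mul, ← Finset.sum_const]
    exact Finset.sum_le_sum fun z _ => sumReps_le_card X z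
  have h3 : 4 * M * ∑ z ∈ P', sumReps X z ≤ M * m ^ 2 := by
    rw [Finset.mul_sum]
    calc ∑ z ∈ P', 4 * M * sumReps X z ≤ ∑ _z ∈ P', m ^ 2 :=
          Finset.sum_le_sum fun z hz => (not_le.1 (Finset.mem_filter.1 hz).2).le
      _ = P'.card * m ^ 2 := by simp
      _ ≤ M * m ^ 2 := by exact Nat.mul_le_mul_right _ (Finset.card_filter_le _ _)
  have h4 : 4 * ∑ z ∈ P', sumReps X z ≤ m ^ 2 := by
    refine Nat.le_of_mul_le_mul_left ?_ hM
    linarith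
  refine Nat.le_of_mul_le_mul_left ?_ hm
  nlinarith

/-- An equation x + y = t + x' makes `y` a representation of x + t. At least |X|/2 values of `y` are
shared among at most 2|X + X|/|X| values of `t`, so some x + t is popular. Thus `x` is an element of
`T` plus a popular sum. -/
theorem exists_popular_add {X T : Finset V} (hX : X.Nonempty)
    (hT : T.card * X.card ≤ 2 * (X + X).card) {x : V}
    (hx : X.card ≤ 2 * (X.filter fun y => x + y ∈ T + X).card) :
    ∃ t ∈ T, X.card ^ 2 ≤ 4 * (X + X).card * sumReps X (x + t) := by
  by_contra! hcon
  set m := X.card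
  set M := (X + X).card
  have hm : 0 < m := hX.card_pos
  have hM : 0 < M := (hX.add hX).card_pos
  have h1 : (X.filter fun y => x + y ∈ T + X).card ≤ ∑ t ∈ T, sumReps X (x + t) := by
    refine le_trans (Finset.card_le_card ?_) Finset.card_biUnion_le
    intro y hy
    rw [Finset.mem_filter] at hy
    obtain ⟨t, ht, x', hx', h⟩ := Finset.mem_add.1 hy.2
    refine Finset.mem_biUnion.2 ⟨t, ht, Finset.mem_filter.2 ⟨hy.1, ?_⟩⟩
    have : y + (x + t) = x' := by
      rw [← add_assoc, add_comm y x, ← h, add_comm t x', add_assoc, ZModModule.add_self, add_zero]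
    rwa [this]
  have hTne : T.Nonempty := by
    rw [Finset.nonempty_iff_ne_empty]
    rintro rfl
    simp at hx
    omega
  have h2 : 4 * M * ∑ t ∈ T, sumReps X (x + t) < T.card * m ^ 2 := by
    calc _ = ∑ t ∈ T, 4 * M * sumReps X (x + t) := Finset.mul_sum _ _ _
      _ < ∑ _t ∈ T, m ^ 2 := Finset.sum_lt_sum_of_nonempty hTne hcon
      _ = _ := by simp
  have h3 : T.card * m ^ 2 ≤ 2 * M * m := by nlinarith
  nlinarith

/-- The weight of a pair of independent random sets of density `p`, encoded by their indicator
functions. -/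
noncomputable def pairWeight [Fintype V] (p : ℝ) (h : V → Bool × Bool) : ℝ :=
  ∏ y, (bif (h y).1 then p else 1 - p) * (bif (h y).2 then p else 1 - p)

theorem sum_pairWeight_mul_prod [Fintype V] (p : ℝ) (φ : V → Bool × Bool → ℝ) :
    ∑ h, pairWeight p h * ∏ y, φ y (h y)
      = ∏ y, (p * p * φ y (true, true) + p * (1 - p) * φ y (true, false)
          + (1 - p) * p * φ y (false, true) + (1 - p) * (1 - p) * φ y (false, false)) := by
  unfold pairWeight
  simp only [← Finset.prod_mul_distrib]
  have := Finset.prod_univ_sum (fun _ : V => (Finset.univ : Finset (Bool × Bool)))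
    (fun y b => (bif b.1 then p else 1 - p) * (bif b.2 then p else 1 - p) * φ y b)
  rw [Fintype.piFinset_univ] at this
  rw [← this]
  refine Finset.prod_congr rfl fun y _ => ?_
  simp [Fintype.sum_prod_type]
  ring

theorem sum_pairWeight [Fintype V] (p : ℝ) : ∑ h : V → Bool × Bool, pairWeight p h = 1 := by
  have := sum_pairWeight_mul_prod (V := V) p (fun _ _ => 1)
  simp only [Finset.prod_const_one, mul_one] at this
  rw [this]
  exact Finset.prod_eq_one fun _ _ => by ring

theorem sum_pairWeight_fst [Fintype V] (p : ℝ) (x : V) :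
    ∑ h : V → Bool × Bool, pairWeight p h * (if (h x).1 then 1 else 0) = p := by
  have := sum_pairWeight_mul_prod (V := V) p (fun y b => if y = x then (if b.1 then 1 else 0) else 1)
  simp only [Finset.prod_ite_eq', Finset.mem_univ, if_true] at this
  rw [this, Finset.prod_eq_single x]
  · simp; ring
  · intro y _ hy; simp [hy]; ring
  · simp

theorem sum_pairWeight_snd [Fintype V] (p : ℝ) (x : V) :
    ∑ h : V → Bool × Bool, pairWeight p h * (if (h x).2 then 1 else 0) = p := by
  have := sum_pairWeight_mul_prod (V := V) p (fun y b => if y = x then (if b.2 then 1 else 0) else 1)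
  simp only [Finset.prod_ite_eq', Finset.mem_univ, if_true] at this
  rw [this, Finset.prod_eq_single x]
  · simp; ring
  · intro y _ hy; simp [hy]; ring
  · simp

/-- Two independent random sets are used so that the events "y in the first, y + z in the second"
are independent for distinct y; with a single set, y and y + z would interfere. -/
theorem sum_pairWeight_avoid [Fintype V] (p : ℝ) (R : Finset V) (z : V) :
    ∑ h : V → Bool × Bool,
      pairWeight p h * (if ∀ y ∈ R, ¬ ((h y).1 = true ∧ (h (y + z)).2 = true) then 1 else 0)
      = (1 - p ^ 2) ^ R.card := by
  -- Shifting the second set by `z` preserves the weight and turns the event into a product over y.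
  let σ : (V → Bool × Bool) ≃ (V → Bool × Bool) :=
    { toFun := fun h y => ((h y).1, (h (y + z)).2)
      invFun := fun h y => ((h y).1, (h (y - z)).2)
      left_inv := fun h => by ext y <;> simp
      right_inv := fun h => by ext y <;> simp }
  have hσ : ∀ h, pairWeight p (σ h) = pairWeight p h := by
    intro h
    unfold pairWeight
    rw [Finset.prod_mul_distrib, Finset.prod_mul_distrib]
    congr 1
    exact Equiv.prod_comp (Equiv.addRight z) (fun y => bif (h y).2 then p else 1 - p)
  have key : ∀ h : V → Bool × Bool,
      (if ∀ y ∈ R, ¬ ((h y).1 = true ∧ (h (y + z)).2 = true) then (1 : ℝ) else 0)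
      = ∏ y, (fun (y : V) (b : Bool × Bool) =>
          if y ∈ R then (if b.1 = true ∧ b.2 = true then (0 : ℝ) else 1) else 1) y (σ h y) := by
    intro h
    simp only [Finset.prod_ite_mem, Finset.univ_inter]
    split_ifs with hh
    · refine (Finset.prod_eq_one fun y hy => ?_).symm
      exact if_neg (hh y hy)
    · push Not at hh
      obtain ⟨y, hy, h'⟩ := hh
      refine (Finset.prod_eq_zero hy ?_).symm
      exact if_pos h'
  rw [← Equiv.sum_comp σ.symm]
  have hsum : ∀ h, pairWeight p (σ.symm h) = pairWeight p h := fun h => by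
    rw [← hσ, Equiv.apply_symm_apply]
  simp only [key, Equiv.apply_symm_apply, hsum]
  refine (sum_pairWeight_mul_prod p fun (y : V) (b : Bool × Bool) =>
    if y ∈ R then (if b.1 = true ∧ b.2 = true then (0 : ℝ) else 1) else 1).trans ?_
  rw [← Finset.prod_const, ← Finset.prod_subset (Finset.subset_univ R)]
  · refine Finset.prod_congr rfl fun y hy => ?_
    simp [hy]; ring
  · intro y _ hy
    simp [hy]; ring

/-- Random sampling: a small subset `S` of `X` whose sumset contains prescribed popular sums. -/
theorem exists_subset_add_superset [Fintype V] {X P : Finset V} (hX : X.Nonempty) {θ : ℝ}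
    (hθ : 0 < θ) (hP : ∀ z ∈ P, θ ≤ sumReps X z) (hPcard : P.card ≤ 2 * X.card) :
    ∃ S ⊆ X, P ⊆ S + S ∧
      (S.card : ℝ) ≤ 2 * √(Real.log (2 * (X.card : ℝ) ^ 2) / θ) * X.card + 1 := by
  set m := X.card with hm
  have hmpos : 0 < m := hX.card_pos
  have hm1 : (1 : ℝ) ≤ m := by exact_mod_cast hmpos
  -- Chosen so that a given sum in `P` is missed with probability at most exp(-p²θ) = 1/(2m²).
  set p := √(Real.log (2 * (m : ℝ) ^ 2) / θ) with hp
  have hlog : 0 < Real.log (2 * (m : ℝ) ^ 2) := Real.log_pos (by nlinarith)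
  have hp0 : 0 < p := Real.sqrt_pos.2 (div_pos hlog hθ)
  have hp2 : p ^ 2 * θ = Real.log (2 * (m : ℝ) ^ 2) := by
    rw [hp, Real.sq_sqrt (div_pos hlog hθ).le, div_mul_cancel₀ _ hθ.ne']
  -- If the bound is no better than |X|, the whole of `X` serves. Otherwise `p < 1`, and the strict
  -- inequality is used again to rule out missed sums.
  by_cases hbig : (m : ℝ) ≤ 2 * p * m + 1
  · refine ⟨X, subset_rfl, fun z hz => mem_add_of_sumReps_pos ?_, hbig⟩
    have := hθ.trans_le (hP z hz)
    exact_mod_cast this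
  rw [not_le] at hbig
  have hp1 : p < 1 := by nlinarith
  let S₁ : (V → Bool × Bool) → Finset V := fun h => X.filter fun y => (h y).1 = true
  let S₂ : (V → Bool × Bool) → Finset V := fun h => X.filter fun y => (h y).2 = true
  let R : V → Finset V := fun z => X.filter fun y => y + z ∈ X
  let U : (V → Bool × Bool) → Finset V := fun h =>
    P.filter fun z => ∀ y ∈ R z, ¬ ((h y).1 = true ∧ (h (y + z)).2 = true)
  have hwpos : ∀ h : V → Bool × Bool, 0 < pairWeight p h := by
    intro h
    refine Finset.prod_pos fun y _ => mul_pos ?_ ?_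
    · cases (h y).1 <;> simp <;> linarith
    · cases (h y).2 <;> simp <;> linarith
  have hE1 : ∑ h, pairWeight p h * ((S₁ h).card : ℝ) = p * m := by
    simp only [S₁, Finset.card_filter, Nat.cast_sum, Finset.mul_sum]
    rw [Finset.sum_comm]
    simp only [Nat.cast_ite, Nat.cast_one, Nat.cast_zero, sum_pairWeight_fst]
    rw [Finset.sum_const, nsmul_eq_mul, mul_comm]
  have hE2 : ∑ h, pairWeight p h * ((S₂ h).card : ℝ) = p * m := by
    simp only [S₂, Finset.card_filter, Nat.cast_sum, Finset.mul_sum]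
    rw [Finset.sum_comm]
    simp only [Nat.cast_ite, Nat.cast_one, Nat.cast_zero, sum_pairWeight_snd]
    rw [Finset.sum_const, nsmul_eq_mul, mul_comm]
  have hE3 : ∑ h, pairWeight p h * ((U h).card : ℝ) ≤ 1 / m := by
    simp only [U, Finset.card_filter, Nat.cast_sum, Finset.mul_sum]
    rw [Finset.sum_comm]
    simp only [Nat.cast_ite, Nat.cast_one, Nat.cast_zero, sum_pairWeight_avoid]
    calc ∑ z ∈ P, ((1 - p ^ 2) ^ (R z).card : ℝ) ≤ ∑ _z ∈ P, (2 * (m : ℝ) ^ 2)⁻¹ := by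
          refine Finset.sum_le_sum fun z hz => ?_
          have h1 : θ ≤ ((R z).card : ℝ) := hP z hz
          calc ((1 - p ^ 2) ^ (R z).card : ℝ) ≤ (Real.exp (- p ^ 2)) ^ (R z).card := by
                refine pow_le_pow_left₀ (by nlinarith) ?_ _
                have := Real.add_one_le_exp (- p ^ 2)
                linarith
            _ = Real.exp (- (p ^ 2 * (R z).card)) := by rw [← Real.exp_nat_mul]; ring_nf
            _ ≤ Real.exp (- Real.log (2 * (m : ℝ) ^ 2)) := by
                rw [← hp2]; gcongr
            _ = _ := by rw [Real.exp_neg, Real.exp_log (by positivity)]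
      _ = P.card * (2 * (m : ℝ) ^ 2)⁻¹ := by simp
      _ ≤ (2 * m : ℝ) * (2 * (m : ℝ) ^ 2)⁻¹ := by gcongr; exact_mod_cast hPcard
      _ = 1 / m := by field_simp
  -- First moment with penalty `m` per missed sum: a single miss would already cost m > 2pm + 1, so
  -- this outcome misses nothing.
  obtain ⟨h, hh⟩ : ∃ h, ((S₁ h).card : ℝ) + (S₂ h).card + m * (U h).card ≤ 2 * p * m + 1 := by
    by_contra! hcon
    have h1 : ∑ h, pairWeight p h * (2 * p * m + 1)
        < ∑ h, pairWeight p h * (((S₁ h).card : ℝ) + (S₂ h).card + m * (U h).card) :=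
      Finset.sum_lt_sum_of_nonempty Finset.univ_nonempty fun h _ =>
        mul_lt_mul_of_pos_left (hcon h) (hwpos h)
    rw [← Finset.sum_mul, sum_pairWeight] at h1
    simp only [mul_add, Finset.sum_add_distrib, hE1, hE2] at h1
    have h2 : ∑ h, pairWeight p h * (m * ((U h).card : ℝ))
        = m * ∑ h, pairWeight p h * ((U h).card : ℝ) := by
      rw [Finset.mul_sum]
      exact Finset.sum_congr rfl fun _ _ => by ring
    rw [h2] at h1
    have h3 : (m : ℝ) * ∑ h, pairWeight p h * ((U h).card : ℝ) ≤ 1 := by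
      calc _ ≤ (m : ℝ) * (1 / m) := by gcongr
        _ = 1 := by field_simp
    linarith
  have hU : U h = ∅ := by
    by_contra hne
    have h1 : 1 ≤ (U h).card := Finset.card_pos.2 (Finset.nonempty_iff_ne_empty.2 hne)
    have h2 : (1 : ℝ) ≤ (U h).card := by exact_mod_cast h1
    have h3 : (m : ℝ) * 1 ≤ m * (U h).card := by gcongr
    have h4 : (0 : ℝ) ≤ (S₁ h).card := by positivity
    have h5 : (0 : ℝ) ≤ (S₂ h).card := by positivity
    linarith
  refine ⟨S₁ h ∪ S₂ h, Finset.union_subset (Finset.filter_subset _ _) (Finset.filter_subset _ _),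
    fun z hz => ?_, ?_⟩
  · have hzU : z ∉ U h := by rw [hU]; exact Finset.notMem_empty z
    rw [Finset.mem_filter, not_and] at hzU
    have := hzU hz
    push Not at this
    obtain ⟨y, hy, h1, h2⟩ := this
    have hy := Finset.mem_filter.1 hy
    refine Finset.mem_add.2 ⟨y, Finset.mem_union_left _ (Finset.mem_filter.2 ⟨hy.1, h1⟩),
      y + z, Finset.mem_union_right _ (Finset.mem_filter.2 ⟨hy.2, h2⟩), ?_⟩
    rw [← add_assoc, ZModModule.add_self, zero_add]
  · have h1 : ((S₁ h ∪ S₂ h).card : ℝ) ≤ (S₁ h).card + (S₂ h).card := by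
      exact_mod_cast Finset.card_union_le _ _
    have h2 : (0 : ℝ) ≤ m * (U h).card := by positivity
    linarith

/-- The structure of a set `X` in terms of its sumset: `X` has small rank, it is contained in
`T + S + S` with `T` and `S` small, and the sumset of `S` is large. -/
theorem exists_structure [Fintype V] (X : Finset V) (hX : X.Nonempty) :
    ∃ T S Y : Finset V, T ⊆ X ∧ S ⊆ X ∧ X ⊆ T + S + S ∧ 3 * X.card ≤ 4 * (S + S).card ∧
      T.card * X.card ≤ 2 * (X + X).card ∧
      (S.card : ℝ) ≤ 4 * √((X + X).card * Real.log (2 * (X.card : ℝ) ^ 2)) + 1 ∧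
      (X : Set V) ⊆ Submodule.span (ZMod 2) (Y : Set V) ∧
      (Y.card : ℝ) ≤ 6 * (X + X).card / X.card + 4 * Real.logb 2 X.card := by
  obtain ⟨T, hTX, hTcard, hT⟩ := exists_subset_half_covering X
  have hmpos : 0 < X.card := hX.card_pos
  have hMpos : 0 < (X + X).card := (hX.add hX).card_pos
  have hTcard' : T.card * X.card ≤ 2 * (X + X).card :=
    hTcard.trans (by gcongr)
  obtain ⟨Y, b, c, hY, hYcard, hb, hc⟩ := exists_span_of_half_covering hX hT
  choose! f hf hf' using fun x hx => exists_popular_add hX hTcard' (hT x hx)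
  -- The sample must realise two families: popular sums, making S + S large, and the sums x + f x,
  -- giving the covering. Truncating the first at |X| keeps the total within 2|X|.
  obtain ⟨P, hPsub, hPcard⟩ := Finset.exists_subset_card_eq
    (s := (X + X).filter fun z => X.card ^ 2 ≤ 4 * (X + X).card * sumReps X z)
    (n := min X.card _) (min_le_right _ _)
  have hpop : ∀ z, X.card ^ 2 ≤ 4 * (X + X).card * sumReps X z →
      (X.card : ℝ) ^ 2 / (4 * (X + X).card) ≤ sumReps X z := fun z hz => by
    rw [div_le_iff₀' (by positivity)]
    exact_mod_cast hz
  obtain ⟨S, hSX, hS, hScard⟩ := exists_subset_add_superset (P := P ∪ X.image fun x => x + f x) hX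
    (θ := (X.card : ℝ) ^ 2 / (4 * (X + X).card)) (by positivity) (fun z hz => by
      rw [Finset.mem_union] at hz
      rcases hz with hz | hz
      · exact hpop z (Finset.mem_filter.1 (hPsub hz)).2
      · obtain ⟨x, hx, rfl⟩ := Finset.mem_image.1 hz
        exact hpop _ (hf' x hx)) (by
      have h1 : (X.image fun x => x + f x).card ≤ X.card := Finset.card_image_le
      have h2 := Finset.card_union_le P (X.image fun x => x + f x)
      have h3 : P.card ≤ X.card := hPcard.trans_le (min_le_left _ _)
      omega)
  refine ⟨T, S, Y, hTX, hSX, fun x hx => ?_, ?_, hTcard', ?_, hY, ?_⟩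
  · have h1 := hS (Finset.mem_union_right _ (Finset.mem_image_of_mem _ hx))
    have h2 : x = f x + (x + f x) := by
      rw [add_comm x, ← add_assoc, ZModModule.add_self, zero_add]
    rw [h2, add_assoc]
    exact Finset.add_mem_add (hf x hx) h1
  · have h1 := Finset.card_le_card (Finset.subset_union_left.trans hS)
    have h2 := three_mul_card_le_popular X hX
    omega
  · refine hScard.trans_eq ?_
    congr 1
    have h1 : Real.log (2 * (X.card : ℝ) ^ 2) / ((X.card : ℝ) ^ 2 / (4 * (X + X).card))
        = (X + X).card * Real.log (2 * (X.card : ℝ) ^ 2) * (2 / X.card) ^ 2 := by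
      field_simp
      ring
    rw [h1, Real.sqrt_mul' _ (by positivity), Real.sqrt_sq (by positivity)]
    field_simp
    ring
  · have hm : (0 : ℝ) < X.card := by exact_mod_cast hmpos
    have h1 : (b : ℝ) ≤ 4 * Real.logb 2 X.card := by
      have h2 : (2 : ℝ) ^ (b : ℝ) ≤ (X.card : ℝ) ^ 4 := by
        rw [Real.rpow_natCast]; exact_mod_cast hb
      have h3 := (Real.le_logb_iff_rpow_le (by norm_num) (by positivity)).2 h2
      rwa [Real.logb_pow] at h3
    have h2 : (T.card : ℝ) + c ≤ 6 * (X + X).card / X.card := by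
      rw [le_div_iff₀ hm, add_mul]
      have h3 : (T.card : ℝ) * X.card ≤ 2 * (X + X).card := by exact_mod_cast hTcard'
      have h4 : (c : ℝ) * X.card ≤ 4 * (X + X).card := by exact_mod_cast hc
      linarith
    have h3 : (Y.card : ℝ) ≤ T.card + b + c := by exact_mod_cast hYcard
    linarith

end Sampling

/-! ### Encoding cliques and the union bound -/

section UnionBound

open scoped Pointwise

set_option linter.unusedSectionVars false

theorem exists_fin_subset_image {α : Type*} [DecidableEq α] [Inhabited α] (S : Finset α) {s : ℕ}
    (h : S.card ≤ s) : ∃ a : Fin s → α, S ⊆ Finset.univ.image a := by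
  refine ⟨fun i => if h : (i : ℕ) < S.card then (S.equivFin.symm ⟨i, h⟩ : α) else default, ?_⟩
  intro x hx
  refine Finset.mem_image.2 ⟨⟨S.equivFin ⟨x, hx⟩, (S.equivFin ⟨x, hx⟩).2.trans_le h⟩,
    Finset.mem_univ _, ?_⟩
  simp

theorem exists_fin_image_eq {α : Type*} [DecidableEq α] {S : Finset α} (hS : S.Nonempty) {s : ℕ}
    (h : S.card ≤ s) : ∃ a : Fin s → α, Finset.univ.image a = S := by
  obtain ⟨x₀, hx₀⟩ := hS
  refine ⟨fun i => if h : (i : ℕ) < S.card then (S.equivFin.symm ⟨i, h⟩ : α) else x₀, ?_⟩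
  refine subset_antisymm ?_ ?_
  · intro x hx
    obtain ⟨i, _, rfl⟩ := Finset.mem_image.1 hx
    split_ifs
    · exact Subtype.coe_prop _
    · exact hx₀
  · intro x hx
    refine Finset.mem_image.2 ⟨⟨S.equivFin ⟨x, hx⟩, (S.equivFin ⟨x, hx⟩).2.trans_le h⟩,
      Finset.mem_univ _, ?_⟩
    simp

variable {V : Type*} [AddCommGroup V] [Module (ZMod 2) V] [DecidableEq V]

/-- `X` is contained in the span of at most `D` vectors. -/
def RankLE (D : ℕ) (X : Finset V) : Prop :=
  ∃ Y : Finset V, (X : Set V) ⊆ Submodule.span (ZMod 2) (Y : Set V) ∧ Y.card ≤ D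

theorem RankLE.mono {D : ℕ} {X X' : Finset V} (h : RankLE D X) (hX : X' ⊆ X) : RankLE D X' := by
  obtain ⟨Y, hY, hYD⟩ := h
  exact ⟨Y, (Finset.coe_subset.2 hX).trans hY, hYD⟩

theorem RankLE.min_finrank [Fintype V] {D : ℕ} {X : Finset V} (h : RankLE D X) :
    RankLE (min (Module.finrank (ZMod 2) V) D) X := by
  rcases le_total (Module.finrank (ZMod 2) V) D with hD | hD
  · rw [min_eq_left hD]
    refine ⟨Finset.univ.image (Module.finBasis (ZMod 2) V), fun x _ => ?_, ?_⟩
    · simp [(Module.finBasis (ZMod 2) V).span_eq]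
    · exact Finset.card_image_le.trans (by simp)
  · rwa [min_eq_right hD]

/-- Once `v` is fixed, each element of `X` costs only `D` bits; this is how small rank pays in the
union bound. -/
theorem RankLE.exists_param {D : ℕ} {X : Finset V} (h : RankLE D X) :
    ∃ v : Fin D → V, ∃ f : V → Fin D → ZMod 2, ∀ x ∈ X, ∑ i, f x i • v i = x := by
  obtain ⟨Y, hY, hYD⟩ := h
  have : Inhabited V := ⟨0⟩
  obtain ⟨v, hv⟩ := exists_fin_subset_image Y hYD
  refine ⟨v, ?_⟩
  have h1 : ∀ x ∈ X, ∃ c : Fin D → ZMod 2, ∑ i, c i • v i = x := by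
    intro x hx
    rw [← Submodule.mem_span_range_iff_exists_fun]
    refine Submodule.span_mono ?_ (hY hx)
    intro y hy
    obtain ⟨i, _, rfl⟩ := Finset.mem_image.1 (hv hy)
    exact Set.mem_range_self i
  choose! f hf using h1
  exact ⟨f, hf⟩

theorem RankLE.exists_fin_param {D : ℕ} {X : Finset V} {v : Fin D → V} {f : V → Fin D → ZMod 2}
    (hf : ∀ x ∈ X, ∑ i, f x i • v i = x) {S : Finset V} (hSX : S ⊆ X) (hS : S.Nonempty) {s : ℕ}
    (hs : S.card ≤ s) :
    ∃ c : Fin s → Fin D → ZMod 2, Finset.univ.image (fun j => ∑ i, c j i • v i) = S := by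
  obtain ⟨a, ha⟩ := exists_fin_image_eq hS hs
  refine ⟨fun j => f (a j), ?_⟩
  rw [← ha]
  congr 1
  ext j : 1
  refine hf _ (hSX ?_)
  rw [← ha]
  exact Finset.mem_image_of_mem _ (Finset.mem_univ _)

variable [Fintype V]

theorem card_eq_two_pow_finrank : Fintype.card V = 2 ^ Module.finrank (ZMod 2) V := by
  have := Module.card_eq_pow_finrank (K := ZMod 2) (V := V)
  rwa [ZMod.card] at this

/-- A code for `S` consists of `D` spanning vectors and `s` coefficient vectors in 𝔽₂^D. The 1 in `g
+ 1` pays for erasing 0. -/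
theorem subsetDensity_exists_add_self_le (D s g : ℕ) :
    subsetDensity (fun A : Finset V => ∃ S : Finset V, S.Nonempty ∧ S.card ≤ s ∧ RankLE D S ∧
        g + 1 ≤ (S + S).card ∧ (S + S).erase 0 ⊆ A)
      ≤ 2 ^ (Module.finrank (ZMod 2) V * D + D * s) * ((2 : ℝ) ^ g)⁻¹ := by
  let E : (Fin D → V) × (Fin s → Fin D → ZMod 2) → Finset V := fun ω =>
    Finset.univ.image (fun j => ∑ i, ω.2 j i • ω.1 i)
  refine (subsetDensity_mono ?_).trans ((subsetDensity_exists_superset_le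
    (fun ω => (E ω + E ω).erase 0) g).trans_eq ?_)
  · rintro A ⟨S, hS, hs, hD, hg, hA⟩
    obtain ⟨v, f, hf⟩ := hD.exists_param
    obtain ⟨c, hc⟩ := RankLE.exists_fin_param hf subset_rfl hS hs
    have hE : E (v, c) = S := hc
    refine ⟨(v, c), ?_, ?_⟩
    · rw [hE]
      have := Finset.pred_card_le_card_erase (s := S + S) (a := 0)
      omega
    · rwa [hE]
  · simp only [Fintype.card_prod, Fintype.card_fun, Fintype.card_fin, ZMod.card,
      card_eq_two_pow_finrank (V := V)]
    push_cast
    rw [← pow_mul, ← pow_mul, ← pow_add]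

/-- `S` and `T` are coded by coordinates in a common spanning family; each of the `m` elements of
`X` is then one of t·s·s index triples. -/
theorem subsetDensity_exists_cover_le (D s t m g : ℕ) :
    subsetDensity (fun A : Finset V => ∃ X T S : Finset V, X.Nonempty ∧ X.card = m ∧ T ⊆ X ∧ S ⊆ X ∧
        X ⊆ T + S + S ∧ T.card ≤ t ∧ S.card ≤ s ∧ RankLE D X ∧
        g + 1 ≤ (X + X).card ∧ (X + X).erase 0 ⊆ A)
      ≤ 2 ^ (Module.finrank (ZMod 2) V * D + D * s + D * t) * ((t * s * s : ℕ) : ℝ) ^ m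
        * ((2 : ℝ) ^ g)⁻¹ := by
  let E : (Fin D → V) × (Fin s → Fin D → ZMod 2) × (Fin t → Fin D → ZMod 2) ×
      (Fin m → (Fin t × Fin s) × Fin s) → Finset V := fun ω =>
    Finset.univ.image (fun k => (∑ i, ω.2.2.1 (ω.2.2.2 k).1.1 i • ω.1 i)
      + (∑ i, ω.2.1 (ω.2.2.2 k).1.2 i • ω.1 i) + (∑ i, ω.2.1 (ω.2.2.2 k).2 i • ω.1 i))
  refine (subsetDensity_mono ?_).trans ((subsetDensity_exists_superset_le
    (fun ω => (E ω + E ω).erase 0) g).trans_eq ?_)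
  · rintro A ⟨X, T, S, hX, hm, hTX, hSX, hcov, ht, hs, hD, hg, hA⟩
    have hTS := (hX.mono hcov)
    have hS : S.Nonempty := (Finset.add_nonempty.1 hTS).2
    have hT : T.Nonempty := (Finset.add_nonempty.1 (Finset.add_nonempty.1 hTS).1).1
    obtain ⟨v, f, hf⟩ := hD.exists_param
    obtain ⟨c, hc⟩ := RankLE.exists_fin_param hf hSX hS hs
    obtain ⟨d, hd⟩ := RankLE.exists_fin_param hf hTX hT ht
    obtain ⟨a, ha⟩ := exists_fin_image_eq hX hm.le
    have hex : ∀ k : Fin m, ∃ w : (Fin t × Fin s) × Fin s, (∑ i, d w.1.1 i • v i)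
        + (∑ i, c w.1.2 i • v i) + (∑ i, c w.2 i • v i) = a k := by
      intro k
      have hk : a k ∈ X := by rw [← ha]; exact Finset.mem_image_of_mem _ (Finset.mem_univ _)
      obtain ⟨u, hu, z, hz, h1⟩ := Finset.mem_add.1 (hcov hk)
      obtain ⟨x, hx, y, hy, rfl⟩ := Finset.mem_add.1 hu
      rw [← hd] at hx
      rw [← hc] at hy hz
      obtain ⟨i, _, rfl⟩ := Finset.mem_image.1 hx
      obtain ⟨j, _, rfl⟩ := Finset.mem_image.1 hy
      obtain ⟨l, _, rfl⟩ := Finset.mem_image.1 hz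
      exact ⟨((i, j), l), h1⟩
    choose w hw using hex
    have hE : E (v, c, d, w) = X := by
      rw [← ha]
      exact congrArg (fun f => Finset.univ.image f) (funext hw)
    refine ⟨(v, c, d, w), ?_, ?_⟩
    · rw [hE]
      have := Finset.pred_card_le_card_erase (s := X + X) (a := 0)
      omega
    · rwa [hE]
  · simp only [Fintype.card_prod, Fintype.card_fun, Fintype.card_fin, ZMod.card,
      card_eq_two_pow_finrank (V := V)]
    push_cast
    rw [← pow_mul, ← pow_mul, ← pow_mul]
    ring

theorem add_self_erase_subset_of_isClique {A : Set V} {X : Finset V}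
    (h : (cayleySumGraph A).IsClique (X : Set V)) : (((X + X).erase 0 : Finset V) : Set V) ⊆ A := by
  intro z hz
  obtain ⟨hz0, hz⟩ := Finset.mem_erase.1 hz
  obtain ⟨x, hx, y, hy, rfl⟩ := Finset.mem_add.1 hz
  refine (h hx hy ?_).2
  rintro rfl
  exact hz0 (ZModModule.add_self x)

theorem exists_isClique_card_of_le_cliqueNum {G : SimpleGraph V} {m : ℕ} (h : m ≤ G.cliqueNum) :
    ∃ X : Finset V, X.card = m ∧ G.IsClique (X : Set V) := by
  obtain ⟨Y, hY⟩ := G.exists_isNClique_cliqueNum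
  obtain ⟨X, hXY, hX⟩ := Finset.exists_subset_card_eq (h.trans hY.card_eq.ge)
  exact ⟨X, hX, hY.isClique.subset (Finset.coe_subset.2 hXY)⟩

/-- The union bound for the existence of a clique of size `m` in the random Cayley sum graph: the
cliques with sumset of size at most `L` are treated through `S`, the others through their
covering. -/
theorem subsetDensity_le_cliqueNum_le {m : ℕ} (hm : 0 < m) (L : ℕ) {D₀ s₀ g₀ : ℕ}
    (hD₀ : 6 * (L : ℝ) / m + 4 * Real.logb 2 m ≤ D₀)
    (hs₀ : 4 * √(L * Real.log (2 * (m : ℝ) ^ 2)) + 1 ≤ s₀) (hg₀ : 4 * (g₀ + 1) ≤ 3 * m) {B : ℝ} (hB₀ : 0 ≤ B)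
    (hB : ∀ M : ℕ, L < M → ∀ D s t : ℕ, D ≤ Module.finrank (ZMod 2) V →
      (D : ℝ) ≤ 6 * (M : ℝ) / m + 4 * Real.logb 2 m → (t : ℝ) ≤ 2 * M / m → t ≤ m → s ≤ m →
      (s : ℝ) ≤ 4 * √(M * Real.log (2 * (m : ℝ) ^ 2)) + 1 →
      2 ^ (Module.finrank (ZMod 2) V * D + D * s + D * t) * ((t * s * s : ℕ) : ℝ) ^ m
        * ((2 : ℝ) ^ (M - 1))⁻¹ ≤ B) :
    subsetDensity (fun A : Finset V => m ≤ (cayleySumGraph (A : Set V)).cliqueNum)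
      ≤ 2 ^ (Module.finrank (ZMod 2) V * D₀ + D₀ * s₀) * ((2 : ℝ) ^ g₀)⁻¹ + (m ^ 2 + 1) * B := by
  have hmR : (0 : ℝ) < m := by exact_mod_cast hm
  let D : ℕ → ℕ := fun M =>
    -- The trivial caps, the dimension here and `m` for `t` and `s`, keep the code short when `M` is
    -- large.
    min (Module.finrank (ZMod 2) V) ⌊6 * (M : ℝ) / m + 4 * Real.logb 2 m⌋₊
  let t : ℕ → ℕ := fun M => min m ⌊2 * (M : ℝ) / m⌋₊
  let s : ℕ → ℕ := fun M => min m ⌊4 * √(M * Real.log (2 * (m : ℝ) ^ 2)) + 1⌋₊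
  have hlogb : 0 ≤ Real.logb 2 m := Real.logb_nonneg (by norm_num) (by exact_mod_cast hm)
  have hlog : 0 ≤ Real.log (2 * (m : ℝ) ^ 2) := by
    have : (1 : ℝ) ≤ m := by exact_mod_cast hm
    exact Real.log_nonneg (by nlinarith)
  let F : ℕ → Finset V → Prop := fun M A =>
    ∃ X T S : Finset V, X.Nonempty ∧ X.card = m ∧ T ⊆ X ∧ S ⊆ X ∧
        X ⊆ T + S + S ∧ T.card ≤ t M ∧ S.card ≤ s M ∧ RankLE (D M) X ∧
        (M - 1) + 1 ≤ (X + X).card ∧ (X + X).erase 0 ⊆ A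
  calc subsetDensity (fun A : Finset V => m ≤ (cayleySumGraph (A : Set V)).cliqueNum)
      ≤ subsetDensity (fun A : Finset V =>
          (∃ S : Finset V, S.Nonempty ∧ S.card ≤ s₀ ∧ RankLE D₀ S ∧
            g₀ + 1 ≤ (S + S).card ∧ (S + S).erase 0 ⊆ A) ∨
          ∃ M ∈ (Finset.range (m ^ 2 + 1)).filter (L < ·), F M A) := by
        refine subsetDensity_mono fun A hA => ?_
        obtain ⟨X, hXm, hX⟩ := exists_isClique_card_of_le_cliqueNum hA
        have hXne : X.Nonempty := Finset.card_pos.1 (hXm ▸ hm)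
        have hXA : (X + X).erase 0 ⊆ A := by
          exact_mod_cast add_self_erase_subset_of_isClique hX
        have hMpos : 0 < (X + X).card := (hXne.add hXne).card_pos
        obtain ⟨T, S, Y, hT, hS, hcov, hSS, hTc, hSc, hY, hYc⟩ := exists_structure X hXne
        rw [hXm] at hSS hTc hSc hYc
        rcases le_or_gt (X + X).card L with hL | hL
        · left
          have hLR : ((X + X).card : ℝ) ≤ L := by exact_mod_cast hL
          have hTSne := hXne.mono hcov
          refine ⟨S, (Finset.add_nonempty.1 hTSne).2, ?_, ?_, by omega, ?_⟩
          · have : (S.card : ℝ) ≤ s₀ := hSc.trans (le_trans (by gcongr) hs₀)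
            exact_mod_cast this
          · refine RankLE.mono ⟨Y, hY, ?_⟩ hS
            have : (Y.card : ℝ) ≤ D₀ := hYc.trans (le_trans (by gcongr) hD₀)
            exact_mod_cast this
          · exact (Finset.erase_subset_erase _ (Finset.add_subset_add hS hS)).trans hXA
        · right
          refine ⟨(X + X).card, ?_, X, T, S, hXne, hXm, hT, hS, hcov, ?_, ?_, ?_, ?_, hXA⟩
          · rw [Finset.mem_filter, Finset.mem_range, Nat.lt_succ_iff, sq]
            refine ⟨?_, hL⟩
            rw [← hXm]
            exact Finset.card_add_le
          · refine le_min (hXm ▸ Finset.card_le_card hT) (Nat.le_floor ?_)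
            rw [le_div_iff₀ hmR]
            exact_mod_cast hTc
          · exact le_min (hXm ▸ Finset.card_le_card hS) (Nat.le_floor hSc)
          · exact RankLE.min_finrank ⟨Y, hY, Nat.le_floor hYc⟩
          · omega
    _ ≤ _ := subsetDensity_or_le _ _
    _ ≤ 2 ^ (Module.finrank (ZMod 2) V * D₀ + D₀ * s₀) * ((2 : ℝ) ^ g₀)⁻¹
        + ∑ M ∈ (Finset.range (m ^ 2 + 1)).filter (L < ·), subsetDensity (F M) :=
        add_le_add (subsetDensity_exists_add_self_le _ _ _) (subsetDensity_exists_le _ _)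
    _ ≤ 2 ^ (Module.finrank (ZMod 2) V * D₀ + D₀ * s₀) * ((2 : ℝ) ^ g₀)⁻¹
        + ∑ M ∈ (Finset.range (m ^ 2 + 1)).filter (L < ·), B := by
        gcongr with M hM
        refine (subsetDensity_exists_cover_le (D M) (s M) (t M) m (M - 1)).trans
          (hB M (Finset.mem_filter.1 hM).2 _ _ _ (min_le_left _ _) ?_ ?_ (min_le_left _ _)
            (min_le_left _ _) ?_)
        · exact (Nat.cast_le.2 (min_le_right _ _)).trans (Nat.floor_le (by positivity))
        · exact (Nat.cast_le.2 (min_le_right _ _)).trans (Nat.floor_le (by positivity))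
        · exact (Nat.cast_le.2 (min_le_right _ _)).trans (Nat.floor_le (by positivity))
    _ ≤ _ := by
        rw [Finset.sum_const, nsmul_eq_mul]
        gcongr
        have h2 := Finset.card_filter_le (Finset.range (m ^ 2 + 1)) (L < ·)
        rw [Finset.card_range] at h2
        exact_mod_cast h2

end UnionBound

/-! ### Numerical estimates for the upper tail -/

section UpperBound

theorem log_two_pos : 0 < Real.log 2 := Real.log_pos one_lt_two

theorem log_two_mul_sq_nonneg {m : ℕ} (hm : 0 < m) : 0 ≤ Real.log (2 * (m : ℝ) ^ 2) := by
  have : (1 : ℝ) ≤ m := by exact_mod_cast hm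
  exact Real.log_nonneg (by nlinarith)

theorem log_two_mul_sq_le {m : ℕ} (hm : 0 < m) {l : ℝ} (hl : 100 ≤ l)
    (hlog : Real.logb 2 m ≤ 1.01 * l) : Real.log (2 * (m : ℝ) ^ 2) ≤ 1.41 * l := by
  have hmR : (0 : ℝ) < m := by exact_mod_cast hm
  rw [Real.log_mul (by norm_num) (by positivity), Real.log_pow]
  have h1 : Real.log m = Real.logb 2 m * Real.log 2 := by
    rw [Real.logb, div_mul_cancel₀ _ (Real.log_pos (by norm_num)).ne']
  have h2 := Real.log_two_lt_d9
  have h3 := log_two_pos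
  push_cast
  rw [h1]
  nlinarith

/-- The leading cost is n·D₀ ≤ 186·n·l, where 186 allows for 6·30 from the doubling and 4·1.01 from
the logarithm. It must stay below 3m/4 ≥ 231·n·l; the hypothesis `hn` makes `s₀` at most n/10, so
D₀·s₀ fits in the gap. -/
theorem small_sumset_bound {n m L D₀ s₀ : ℕ} {l : ℝ} (hl : 100 ≤ l) (hn : 10 ^ 9 * l ^ 3 ≤ n)
    (hm₁ : 308 * n * l ≤ m) (hm₂ : (m : ℝ) ≤ 309 * n * l) (hlog : Real.logb 2 m ≤ 1.01 * l)
    (hL : (L : ℝ) ≤ 30 * m * l) (hD₀ : (D₀ : ℝ) ≤ 6 * (L : ℝ) / m + 4 * Real.logb 2 m + 1)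
    (hs₀ : (s₀ : ℝ) ≤ 4 * √(L * Real.log (2 * (m : ℝ) ^ 2)) + 2) :
    n * D₀ + D₀ * s₀ + n ≤ 3 * m / 4 - 1 := by
  have hn1 : (10 : ℝ) ^ 15 ≤ n := by
    have : (100 : ℝ) ^ 3 ≤ l ^ 3 := by gcongr
    nlinarith
  have hmR : (0 : ℝ) < m := by nlinarith
  have hm : 0 < m := by exact_mod_cast hmR
  have hlog0 := log_two_mul_sq_nonneg hm
  have hlog' := log_two_mul_sq_le hm hl hlog
  have h1 : (D₀ : ℝ) ≤ 186 * l := by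
    have : 6 * (L : ℝ) / m ≤ 180 * l := by
      rw [div_le_iff₀ hmR]; nlinarith
    linarith
  have h2 : (s₀ : ℝ) ≤ n / 10 := by
    have : √(L * Real.log (2 * (m : ℝ) ^ 2)) ≤ n / 50 := by
      apply Real.sqrt_le_iff.2
      refine ⟨by positivity, ?_⟩
      calc (L : ℝ) * Real.log (2 * (m : ℝ) ^ 2) ≤ (30 * (309 * n * l) * l) * (1.41 * l) := by
            have : (L : ℝ) ≤ 30 * (309 * n * l) * l := hL.trans (by gcongr)
            gcongr
        _ = 13070.7 * (n * l ^ 3) := by ring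
        _ ≤ (n / 50) ^ 2 := by nlinarith
    linarith
  have h3 : (n : ℝ) * D₀ + D₀ * s₀ + n + 3 ≤ 3 * m / 4 := by
    have h4 : (n : ℝ) * D₀ ≤ n * (186 * l) := by gcongr
    have h5 : (D₀ : ℝ) * s₀ ≤ 186 * l * (n / 10) := by gcongr
    have h6 : (100 : ℝ) * n ≤ n * l := by nlinarith
    nlinarith
  have h4 : (4 : ℝ) * (n * D₀ + D₀ * s₀ + n + 3) ≤ 3 * m := by linarith
  have h5 : 4 * (n * D₀ + D₀ * s₀ + n + 3) ≤ 3 * m := by exact_mod_cast h4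
  omega

/-- Of the `M` available bits, D·s takes about 0.68·M and the choice of elements at most 0.101·M, by
the threshold 30·m·l; n·D and D·t are negligible. The surplus 3m absorbs the later sum over `M`. -/
theorem large_sumset_bound {n m M D s t : ℕ} {l : ℝ} (hl : 100 ≤ l) (hn : 1 ≤ n)
    (hm₁ : 308 * n * l ≤ m) (hlog : Real.logb 2 m ≤ 1.01 * l)
    (hM : 30 * m * l ≤ M) (hDn : D ≤ n) (hD : (D : ℝ) ≤ 6 * (M : ℝ) / m + 4 * Real.logb 2 m)
    (ht : (t : ℝ) ≤ 2 * M / m) (htm : t ≤ m) (hsm : s ≤ m)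
    (hs : (s : ℝ) ≤ 4 * √(M * Real.log (2 * (m : ℝ) ^ 2)) + 1) :
    2 ^ (n * D + D * s + D * t) * ((t * s * s : ℕ) : ℝ) ^ m * ((2 : ℝ) ^ (M - 1))⁻¹
      ≤ ((2 : ℝ) ^ (3 * m))⁻¹ := by
  have hnR : (1 : ℝ) ≤ n := by exact_mod_cast hn
  have hmR : (30800 : ℝ) * n ≤ m := by nlinarith
  have hmpos : (0 : ℝ) < m := by linarith
  have hm : 0 < m := by exact_mod_cast hmpos
  have hMR : (3000 : ℝ) * m ≤ M := by nlinarith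
  have hMpos : (0 : ℝ) < M := by linarith
  have hM1 : 1 ≤ M := by exact_mod_cast hMpos
  have hDnR : (D : ℝ) ≤ n := by exact_mod_cast hDn
  have hlog0 := log_two_mul_sq_nonneg hm
  have hlog' := log_two_mul_sq_le hm hl hlog
  obtain ⟨K, hK⟩ : ∃ K : ℝ, K = M / m := ⟨_, rfl⟩
  have hKm : (M : ℝ) = K * m := by rw [hK, div_mul_cancel₀ _ hmpos.ne']
  have hKl : 30 * l ≤ K := by
    rw [hK, le_div_iff₀ hmpos]; linarith
  have hKpos : 0 < K := by linarith
  rw [mul_div_assoc, ← hK] at hD ht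
  have hD' : (D : ℝ) ≤ 6.14 * K := by linarith
  have hKn : K * n * 30800 ≤ M := by rw [hKm]; nlinarith
  have e1 : (n : ℝ) * D ≤ 6.14 * (K * n) := by nlinarith
  have e2 : (D : ℝ) * t ≤ 2 * (K * n) := by
    calc (D : ℝ) * t ≤ n * (2 * K) := by gcongr
      _ = _ := by ring
  have e3 : (D : ℝ) * √(M * Real.log (2 * (m : ℝ) ^ 2)) ≤ 0.17 * M := by
    -- Both bounds on `D` are used, one per factor. With n·l ≤ m/308 and m·K = M this makes
    -- D²·M·log(2m²) a small multiple of M².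
    have h1 : (D : ℝ) ^ 2 ≤ n * (6.14 * K) := by
      rw [sq]; gcongr
    have h2 : (D : ℝ) * √(M * Real.log (2 * (m : ℝ) ^ 2))
        = √((D : ℝ) ^ 2 * (M * Real.log (2 * (m : ℝ) ^ 2))) := by
      rw [Real.sqrt_mul (sq_nonneg _), Real.sqrt_sq (by positivity)]
    rw [h2]
    apply Real.sqrt_le_iff.2
    refine ⟨by positivity, ?_⟩
    have h4 : (0 : ℝ) ≤ K * M := by positivity
    calc (D : ℝ) ^ 2 * (M * Real.log (2 * (m : ℝ) ^ 2)) ≤ n * (6.14 * K) * (M * (1.41 * l)) := by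
          gcongr
      _ = 8.6574 * (n * l) * (K * M) := by ring
      _ ≤ 8.6574 * (m / 308) * (K * M) := by gcongr; linarith
      _ ≤ (0.17 * M) ^ 2 := by
          have : (m : ℝ) * (K * M) = M ^ 2 := by rw [hKm]; ring
          nlinarith
  have e4 : (D : ℝ) * s ≤ 0.68 * M + n := by
    calc (D : ℝ) * s ≤ D * (4 * √(M * Real.log (2 * (m : ℝ) ^ 2)) + 1) := by gcongr
      _ = 4 * (D * √(M * Real.log (2 * (m : ℝ) ^ 2))) + D := by ring
      _ ≤ _ := by linarith
  have e5 : Real.logb 2 m * (3 * m) ≤ 0.101 * M := by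
    calc Real.logb 2 m * (3 * m) ≤ 1.01 * l * (3 * m) := by gcongr
      _ ≤ _ := by linarith
  have hprod : ((t * s * s : ℕ) : ℝ) ^ m ≤ (2 : ℝ) ^ (Real.logb 2 m * (3 * m)) := by
    rw [Real.rpow_mul (by norm_num), Real.rpow_logb (by norm_num) (by norm_num) hmpos]
    calc ((t * s * s : ℕ) : ℝ) ^ m ≤ ((m * m * m : ℕ) : ℝ) ^ m := by
          gcongr
      _ = (m : ℝ) ^ (3 * (m : ℝ)) := by
          rw [Real.rpow_mul hmpos.le, Real.rpow_natCast]
          congr 1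
          push_cast
          rw [show (3 : ℝ) = ((3 : ℕ) : ℝ) by norm_num, Real.rpow_natCast]
          ring
  have hgain : ((n * D + D * s + D * t : ℕ) : ℝ) + Real.logb 2 m * (3 * m) + (3 * m : ℕ)
      ≤ (M - 1 : ℕ) := by
    rw [Nat.cast_sub hM1]
    push_cast
    linarith
  have hfin : (2 : ℝ) ^ (n * D + D * s + D * t) * (2 : ℝ) ^ (Real.logb 2 m * (3 * m))
      * (2 : ℝ) ^ (3 * m) ≤ (2 : ℝ) ^ (M - 1) := by
    rw [← Real.rpow_natCast, ← Real.rpow_natCast, ← Real.rpow_natCast,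
      ← Real.rpow_add (by norm_num), ← Real.rpow_add (by norm_num)]
    exact Real.rpow_le_rpow_of_exponent_le (by norm_num) hgain
  rw [← div_eq_mul_inv, div_le_iff₀ (by positivity), ← div_eq_inv_mul, le_div_iff₀ (by positivity)]
  refine le_trans ?_ hfin
  gcongr

theorem subsetDensity_cliqueNum_gt_le {n : ℕ} {l : ℝ} (hl : 100 ≤ l) (hn : 10 ^ 9 * l ^ 3 ≤ n)
    (hlog : Real.logb 2 (309 * n * l) ≤ 1.01 * l) :
    subsetDensity (fun A : Finset (Fin n → ZMod 2) =>
      308 * n * l < ((cayleySumGraph (A : Set (Fin n → ZMod 2))).cliqueNum : ℝ))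
      ≤ 2 * ((2 : ℝ) ^ n)⁻¹ := by
  have hn1 : (10 : ℝ) ^ 15 ≤ n := by
    have : (100 : ℝ) ^ 3 ≤ l ^ 3 := by gcongr
    nlinarith
  set m := ⌊308 * n * l⌋₊ + 1 with hm
  have hm₁ : 308 * n * l ≤ m := by
    rw [hm]; push_cast; exact (Nat.lt_floor_add_one _).le
  have hm₂ : (m : ℝ) ≤ 309 * n * l := by
    have := Nat.floor_le (a := 308 * n * l) (by positivity)
    rw [hm]; push_cast
    nlinarith
  have hmpos : 0 < m := by omega
  have hmR : (0 : ℝ) < m := by exact_mod_cast hmpos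
  have hlogm : Real.logb 2 m ≤ 1.01 * l :=
    (Real.logb_le_logb_of_le (by norm_num) hmR hm₂).trans hlog
  have hnm : n ≤ m := by
    have : (n : ℝ) ≤ m := by nlinarith
    exact_mod_cast this
  set L := ⌊30 * m * l⌋₊
  have hL : (L : ℝ) ≤ 30 * m * l := Nat.floor_le (by positivity)
  have hlogb : 0 ≤ Real.logb 2 m := Real.logb_nonneg (by norm_num) (by exact_mod_cast hmpos)
  have hsmall := small_sumset_bound hl hn hm₁ hm₂ hlogm hL
    (Nat.ceil_lt_add_one (a := 6 * (L : ℝ) / m + 4 * Real.logb 2 m) (by positivity)).le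
    ((Nat.ceil_lt_add_one (a := 4 * √(L * Real.log (2 * (m : ℝ) ^ 2)) + 1) (by positivity)).le.trans
      (by linarith))
  set D₀ := ⌈6 * (L : ℝ) / m + 4 * Real.logb 2 m⌉₊
  set s₀ := ⌈4 * √(L * Real.log (2 * (m : ℝ) ^ 2)) + 1⌉₊
  have hfr : Module.finrank (ZMod 2) (Fin n → ZMod 2) = n := Module.finrank_fin_fun _
  have hn0 : 1 ≤ n := by
    have : (1 : ℝ) ≤ n := by linarith
    exact_mod_cast this
  have key := subsetDensity_le_cliqueNum_le (V := Fin n → ZMod 2) hmpos L (D₀ := D₀) (s₀ := s₀)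
    (g₀ := 3 * m / 4 - 1) (Nat.le_ceil _) (Nat.le_ceil _) (by omega)
    (B := ((2 : ℝ) ^ (3 * m))⁻¹) (by positivity) (by
      intro M hM D s t hDn hD ht htm hsm hs
      rw [hfr] at hDn ⊢
      exact large_sumset_bound hl hn0 hm₁ hlogm ((Nat.lt_of_floor_lt hM).le) hDn hD ht htm hsm hs)
  rw [hfr] at key
  refine (subsetDensity_mono fun A hA => ?_).trans (key.trans ?_)
  · rw [hm, Nat.succ_le_iff]
    exact (Nat.floor_lt (by positivity)).2 hA
  · have h1 : (2 : ℝ) ^ (n * D₀ + D₀ * s₀) * ((2 : ℝ) ^ (3 * m / 4 - 1))⁻¹ ≤ ((2 : ℝ) ^ n)⁻¹ := by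
      rw [← div_eq_mul_inv, div_le_iff₀ (by positivity), ← div_eq_inv_mul,
        le_div_iff₀ (by positivity), ← pow_add]
      exact pow_le_pow_right₀ (by norm_num) hsmall
    have h2 : ((m : ℝ) ^ 2 + 1) * ((2 : ℝ) ^ (3 * m))⁻¹ ≤ ((2 : ℝ) ^ n)⁻¹ := by
      rw [← div_eq_mul_inv, div_le_iff₀ (by positivity), ← div_eq_inv_mul,
        le_div_iff₀ (by positivity)]
      have h3 : (m : ℝ) ^ 2 + 1 ≤ 2 ^ (2 * m) := by
        have h4 : (m : ℝ) + 1 ≤ 2 ^ m := by exact_mod_cast Nat.lt_two_pow_self (n := m)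
        rw [mul_comm 2 m, pow_mul]
        nlinarith
      calc ((m : ℝ) ^ 2 + 1) * 2 ^ n ≤ 2 ^ (2 * m) * 2 ^ m := by
            gcongr
            norm_num
        _ = 2 ^ (3 * m) := by rw [← pow_add]; congr 1; ring
    linarith

theorem eventually_logb_bounds : ∀ᶠ n : ℕ in atTop, 100 ≤ Real.logb 2 n ∧
    10 ^ 9 * Real.logb 2 n ^ 3 ≤ n ∧ Real.logb 2 (309 * n * Real.logb 2 n) ≤ 1.01 * Real.logb 2 n := by
  have hlog : Tendsto (fun n : ℕ => Real.logb 2 n) atTop atTop :=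
    (Real.tendsto_logb_atTop (by norm_num)).comp tendsto_natCast_atTop_atTop
  have h2 : ∀ᶠ n : ℕ in atTop, 10 ^ 9 * Real.logb 2 n ^ 3 ≤ n := by
    have h := ((isLittleO_log_rpow_rpow_atTop (s := 1) 3 (by norm_num)).bound
      (c := Real.log 2 ^ 3 / 10 ^ 9) (by have := log_two_pos; positivity))
    have h := (tendsto_natCast_atTop_atTop (R := ℝ)).eventually h
    filter_upwards [h, eventually_ge_atTop 1] with n hn h1
    have hn1 : (1 : ℝ) ≤ n := by exact_mod_cast h1
    have hlogn : 0 ≤ Real.log n := Real.log_nonneg hn1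
    have e3 : Real.log n ^ (3 : ℝ) = Real.log n ^ 3 := by
      rw [show (3 : ℝ) = ((3 : ℕ) : ℝ) by norm_num, Real.rpow_natCast]
    rw [Real.rpow_one, e3, Real.norm_of_nonneg (by positivity), Real.norm_of_nonneg (by positivity)]
      at hn
    rw [Real.logb, div_pow, ← mul_div_assoc, div_le_iff₀ (by have := log_two_pos; positivity)]
    linarith
  have h3 : ∀ᶠ x : ℝ in atTop, Real.logb 2 (309 * x) ≤ 0.01 * x := by
    have h := (Real.isLittleO_log_id_atTop.bound (c := 0.01 * Real.log 2 / 2)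
      (by have := log_two_pos; positivity))
    filter_upwards [h, eventually_ge_atTop (1 : ℝ), eventually_ge_atTop (200 * Real.logb 2 309)]
      with x hx hx1 hx2
    rw [id, Real.norm_of_nonneg (Real.log_nonneg hx1), Real.norm_of_nonneg (by linarith)] at hx
    rw [Real.logb_mul (by norm_num) (by positivity)]
    have h4 : Real.logb 2 x ≤ 0.005 * x := by
      rw [Real.logb, div_le_iff₀ log_two_pos]; linarith
    linarith
  filter_upwards [hlog.eventually_ge_atTop 100, h2, hlog.eventually h3, eventually_ge_atTop 1]
    with n hn1 hn2 hn3 hn4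
  refine ⟨hn1, hn2, ?_⟩
  have : (0 : ℝ) < n := by exact_mod_cast hn4
  rw [show 309 * (n : ℝ) * Real.logb 2 n = n * (309 * Real.logb 2 n) by ring,
    Real.logb_mul this.ne' (by positivity)]
  linarith

theorem tendsto_subsetDensity_cliqueNum_gt :
    Tendsto (fun n : ℕ => subsetDensity (fun A : Finset (Fin n → ZMod 2) =>
      308 * n * Real.logb 2 n < ((cayleySumGraph (A : Set (Fin n → ZMod 2))).cliqueNum : ℝ)))
      atTop (𝓝 0) := by
  have h : Tendsto (fun n : ℕ => 2 * ((2 : ℝ) ^ n)⁻¹) atTop (𝓝 0) := by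
    have := (tendsto_inv_atTop_zero.comp
      (tendsto_pow_atTop_atTop_of_one_lt (one_lt_two : (1 : ℝ) < 2))).const_mul 2
    simpa using this
  refine squeeze_zero' (Eventually.of_forall fun n => subsetDensity_nonneg _) ?_ h
  filter_upwards [eventually_logb_bounds] with n hn
  exact subsetDensity_cliqueNum_gt_le hn.1 hn.2.1 hn.2.2

end UpperBound

/-! ### Second moment over graphs of linear maps -/

section LowerBound

set_option linter.unusedSectionVars false

variable {E F V : Type*} [AddCommGroup E] [Module (ZMod 2) E] [AddCommGroup F] [Module (ZMod 2) F]
  [AddCommGroup V] [Module (ZMod 2) V] [Fintype E] [Fintype F] [Fintype V]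
  [DecidableEq E] [DecidableEq F] [DecidableEq V]

/-- The nonzero vectors of the subspace of `V` that is the graph of a linear map. -/
def graphErase (e : (E × F) ≃ₗ[ZMod 2] V) (T : E →ₗ[ZMod 2] F) : Finset V :=
  (Finset.univ.erase (0 : E)).image fun x => e (x, T x)

theorem graph_injective (e : (E × F) ≃ₗ[ZMod 2] V) (T : E →ₗ[ZMod 2] F) :
    Function.Injective fun x => e (x, T x) := fun _ _ h =>
  congrArg Prod.fst (e.injective h)

theorem card_graphErase (e : (E × F) ≃ₗ[ZMod 2] V) (T : E →ₗ[ZMod 2] F) :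
    (graphErase e T).card = Fintype.card E - 1 := by
  rw [graphErase, Finset.card_image_of_injective _ (graph_injective e T),
    Finset.card_erase_of_mem (Finset.mem_univ _), Finset.card_univ]

/-- Two graphs meet exactly over ker(S - T). The overlap depends only on the difference, so the
double sum of the second moment collapses to a single one. -/
theorem card_graphErase_inter (e : (E × F) ≃ₗ[ZMod 2] V) (S T : E →ₗ[ZMod 2] F) :
    (graphErase e S ∩ graphErase e T).card
      = 2 ^ Module.finrank (ZMod 2) (LinearMap.ker (S - T)) - 1 := by
  have h : graphErase e S ∩ graphErase e T
      = ((Finset.univ.filter fun x : E => (S - T) x = 0).erase 0).image fun x => e (x, S x) := by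
    ext z
    simp only [graphErase, Finset.mem_inter, Finset.mem_image, Finset.mem_erase, Finset.mem_filter,
      Finset.mem_univ, and_true, true_and, LinearMap.sub_apply, sub_eq_zero]
    constructor
    · rintro ⟨⟨x, hx, rfl⟩, y, hy, h⟩
      have h := e.injective h
      rw [Prod.mk.injEq] at h
      obtain ⟨rfl, h⟩ := h
      exact ⟨y, ⟨hx, h.symm⟩, rfl⟩
    · rintro ⟨x, ⟨hx, hST⟩, rfl⟩
      exact ⟨⟨x, hx, rfl⟩, x, hx, by rw [hST]⟩
  rw [h, Finset.card_image_of_injective _ (graph_injective e S),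
    Finset.card_erase_of_mem (by simp)]
  congr 1
  classical
  have := Fintype.ofFinite (LinearMap.ker (S - T))
  have h1 := Module.card_eq_pow_finrank (K := ZMod 2) (V := LinearMap.ker (S - T))
  rw [ZMod.card] at h1
  rw [← h1, Fintype.card_subtype]
  congr! 1
  ext x
  simp

theorem card_le_cliqueNum_of_graphErase_subset (e : (E × F) ≃ₗ[ZMod 2] V) (T : E →ₗ[ZMod 2] F)
    {A : Finset V} (h : graphErase e T ⊆ A) :
    Fintype.card E ≤ (cayleySumGraph (A : Set V)).cliqueNum := by
  have hclique : (cayleySumGraph (A : Set V)).IsClique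
      ((Finset.univ.image fun x => e (x, T x) : Finset V) : Set V) := by
    intro a ha b hb hab
    obtain ⟨x, _, rfl⟩ := Finset.mem_image.1 ha
    obtain ⟨y, _, rfl⟩ := Finset.mem_image.1 hb
    refine ⟨hab, h (Finset.mem_image.2 ⟨x + y, ?_, ?_⟩)⟩
    · refine Finset.mem_erase.2 ⟨fun h0 => hab ?_, Finset.mem_univ _⟩
      have : x = y := by
        rw [← ZModModule.sub_eq_add, sub_eq_zero] at h0
        exact h0
      rw [this]
    · rw [← map_add]; simp
  have := hclique.card_le_cliqueNum
  rwa [Finset.card_image_of_injective _ (graph_injective e T), Finset.card_univ] at this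

theorem exists_linearMap_apply_eq {j : ℕ} {w : Fin j → E} (hw : LinearIndependent (ZMod 2) w)
    (c : Fin j → F) : ∃ R : E →ₗ[ZMod 2] F, ∀ i, R (w i) = c i := by
  obtain ⟨R, hR⟩ := LinearMap.exists_extend ((Module.Basis.span hw).constr (ZMod 2) c)
  refine ⟨R, fun i => ?_⟩
  have h1 : w i = (Submodule.span (ZMod 2) (Set.range w)).subtype (Module.Basis.span hw i) := by
    rw [Submodule.subtype_apply, Module.Basis.span_apply]
  rw [h1, ← LinearMap.comp_apply, hR, Module.Basis.constr_basis]

variable [Fintype (E →ₗ[ZMod 2] F)]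

/-- Evaluation at independent vectors maps Hom(E, F) onto F^j, so its kernel has index |F|^j. -/
theorem card_linearMap_apply_eq_zero_mul_le {j : ℕ} {w : Fin j → E}
    (hw : LinearIndependent (ZMod 2) w) :
    (Finset.univ.filter fun R : E →ₗ[ZMod 2] F => ∀ i, R (w i) = 0).card * Fintype.card F ^ j
      ≤ Fintype.card (E →ₗ[ZMod 2] F) := by
  choose ext hext using exists_linearMap_apply_eq (F := F) hw
  have h1 : Fintype.card F ^ j = (Finset.univ : Finset (Fin j → F)).card := by simp
  rw [h1, ← Finset.card_product, ← Finset.card_univ]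
  refine Finset.card_le_card_of_injOn (fun p => p.1 + ext p.2) (fun _ _ => Finset.mem_univ _) ?_
  rintro ⟨R, c⟩ h ⟨R', c'⟩ h' heq
  have h := (Finset.mem_filter.1 (Finset.mem_product.1 h).1).2
  have h' := (Finset.mem_filter.1 (Finset.mem_product.1 h').1).2
  simp only at heq h h'
  have hc : c = c' := by
    ext i
    have := LinearMap.congr_fun heq (w i)
    simpa [h, h', hext] using this
  subst hc
  simpa using heq

/-- Such a map kills a basis of its kernel, one of at most |E|^j independent tuples. -/
theorem card_finrank_ker_eq_mul_le (j : ℕ) :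
    (Finset.univ.filter fun R : E →ₗ[ZMod 2] F =>
        Module.finrank (ZMod 2) (LinearMap.ker R) = j).card * Fintype.card F ^ j
      ≤ Fintype.card E ^ j * Fintype.card (E →ₗ[ZMod 2] F) := by
  classical
  have hsub : (Finset.univ.filter fun R : E →ₗ[ZMod 2] F =>
        Module.finrank (ZMod 2) (LinearMap.ker R) = j)
      ⊆ (Finset.univ.filter fun w : Fin j → E => LinearIndependent (ZMod 2) w).biUnion
          fun w => Finset.univ.filter fun R : E →ₗ[ZMod 2] F => ∀ i, R (w i) = 0 := by
    intro R hR
    have hR := (Finset.mem_filter.1 hR).2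
    let b := Module.finBasisOfFinrankEq (ZMod 2) (LinearMap.ker R) hR
    refine Finset.mem_biUnion.2 ⟨fun i => (b i : E), ?_, ?_⟩
    · refine Finset.mem_filter.2 ⟨Finset.mem_univ _, ?_⟩
      exact b.linearIndependent.map' (LinearMap.ker R).subtype (Submodule.ker_subtype _)
    · exact Finset.mem_filter.2 ⟨Finset.mem_univ _, fun i => (b i).2⟩
  have h1 := (Finset.card_le_card hsub).trans Finset.card_biUnion_le
  calc _ ≤ (∑ w ∈ Finset.univ.filter fun w : Fin j → E => LinearIndependent (ZMod 2) w,
          (Finset.univ.filter fun R : E →ₗ[ZMod 2] F => ∀ i, R (w i) = 0).card)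
          * Fintype.card F ^ j := Nat.mul_le_mul_right _ h1
    _ ≤ ∑ _w ∈ Finset.univ.filter fun w : Fin j → E => LinearIndependent (ZMod 2) w,
          Fintype.card (E →ₗ[ZMod 2] F) := by
        rw [Finset.sum_mul]
        exact Finset.sum_le_sum fun w hw =>
          card_linearMap_apply_eq_zero_mul_le (Finset.mem_filter.1 hw).2
    _ ≤ _ := by
        rw [Finset.sum_const, smul_eq_mul]
        refine Nat.mul_le_mul_right _ ((Finset.card_filter_le _ _).trans ?_)
        simp

/-- Maps are grouped by kernel dimension `j`: injective ones contribute 0, and `h` says that each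
other class contributes at most a proportion 2^(-c). -/
theorem sum_two_pow_ker_sub_one_le {c : ℕ}
    (h : ∀ j, 1 ≤ j → j ≤ Module.finrank (ZMod 2) E →
      2 ^ j + Module.finrank (ZMod 2) E * j + c ≤ Module.finrank (ZMod 2) F * j) :
    ∑ R : E →ₗ[ZMod 2] F,
        ((2 : ℝ) ^ (2 ^ Module.finrank (ZMod 2) (LinearMap.ker R) - 1) - 1)
      ≤ Module.finrank (ZMod 2) E * ((2 : ℝ) ^ c)⁻¹ * Fintype.card (E →ₗ[ZMod 2] F) := by
  classical
  set k := Module.finrank (ZMod 2) E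
  set r := Module.finrank (ZMod 2) F
  let d : (E →ₗ[ZMod 2] F) → ℕ := fun R => Module.finrank (ZMod 2) (LinearMap.ker R)
  have hmaps : ∀ R ∈ (Finset.univ : Finset (E →ₗ[ZMod 2] F)), d R ∈ Finset.range (k + 1) :=
    fun R _ => Finset.mem_range.2 (Nat.lt_succ_of_le (Submodule.finrank_le _))
  rw [← Finset.sum_fiberwise_of_maps_to hmaps, Finset.sum_range_succ']
  have h0 : ∑ R ∈ Finset.univ.filter (fun R => d R = 0), ((2 : ℝ) ^ (2 ^ d R - 1) - 1) = 0 :=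
    Finset.sum_eq_zero fun R hR => by simp [(Finset.mem_filter.1 hR).2]
  have hterm : ∀ j ∈ Finset.range k,
      ∑ R ∈ Finset.univ.filter (fun R => d R = j + 1), ((2 : ℝ) ^ (2 ^ d R - 1) - 1)
      ≤ ((2 : ℝ) ^ c)⁻¹ * Fintype.card (E →ₗ[ZMod 2] F) := by
    intro j hj
    have hj' := h (j + 1) (by omega) (by have := Finset.mem_range.1 hj; omega)
    have hcount := card_finrank_ker_eq_mul_le (E := E) (F := F) (j + 1)
    rw [card_eq_two_pow_finrank (V := E), card_eq_two_pow_finrank (V := F), ← pow_mul, ← pow_mul]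
      at hcount
    have hcount' : ((Finset.univ.filter fun R => d R = j + 1).card : ℝ) * 2 ^ (r * (j + 1))
        ≤ 2 ^ (k * (j + 1)) * Fintype.card (E →ₗ[ZMod 2] F) := by exact_mod_cast hcount
    calc _ ≤ ∑ R ∈ Finset.univ.filter (fun R => d R = j + 1), (2 : ℝ) ^ (2 ^ (j + 1)) := by
          refine Finset.sum_le_sum fun R hR => ?_
          rw [(Finset.mem_filter.1 hR).2]
          have : (2 : ℝ) ^ (2 ^ (j + 1) - 1) ≤ 2 ^ (2 ^ (j + 1)) :=
            pow_le_pow_right₀ (by norm_num) (Nat.sub_le _ _)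
          linarith
      _ = ((Finset.univ.filter fun R => d R = j + 1).card : ℝ) * 2 ^ (2 ^ (j + 1)) := by simp
      _ ≤ _ := by
          rw [← div_eq_inv_mul, le_div_iff₀ (by positivity)]
          refine le_of_mul_le_mul_right (a := (2 : ℝ) ^ (k * (j + 1))) ?_ (by positivity)
          calc _ = ((Finset.univ.filter fun R => d R = j + 1).card : ℝ)
                  * 2 ^ (2 ^ (j + 1) + k * (j + 1) + c) := by rw [pow_add, pow_add]; ring
            _ ≤ ((Finset.univ.filter fun R => d R = j + 1).card : ℝ) * 2 ^ (r * (j + 1)) := by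
                gcongr
                norm_num
            _ ≤ _ := by rw [mul_comm (Fintype.card _ : ℝ)]; exact hcount'
  refine (add_le_add (Finset.sum_le_sum hterm) h0.le).trans_eq ?_
  rw [Finset.sum_const, Finset.card_range, nsmul_eq_mul]
  ring

theorem subsetDensity_cliqueNum_lt_le_of_equiv {c : ℕ} (e : (E × F) ≃ₗ[ZMod 2] V)
    (h : ∀ j, 1 ≤ j → j ≤ Module.finrank (ZMod 2) E →
      2 ^ j + Module.finrank (ZMod 2) E * j + c ≤ Module.finrank (ZMod 2) F * j) :
    subsetDensity (fun A : Finset V => (cayleySumGraph (A : Set V)).cliqueNum < Fintype.card E)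
      ≤ Module.finrank (ZMod 2) E * ((2 : ℝ) ^ c)⁻¹ := by
  have hpos : (0 : ℝ) < Fintype.card (E →ₗ[ZMod 2] F) := by exact_mod_cast Fintype.card_pos
  refine (subsetDensity_mono fun A hA T hT => ?_).trans
    ((subsetDensity_forall_not_superset_le (graphErase e) _ (card_graphErase e)).trans ?_)
  · exact absurd (card_le_cliqueNum_of_graphErase_subset e T hT) (not_le.2 hA)
  · rw [div_le_iff₀ (by positivity)]
    simp only [card_graphErase_inter]
    -- Substitution R = S - T for fixed S.
    calc _ = ∑ _S : E →ₗ[ZMod 2] F, ∑ R : E →ₗ[ZMod 2] F,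
            ((2 : ℝ) ^ (2 ^ Module.finrank (ZMod 2) (LinearMap.ker R) - 1) - 1) :=
          Finset.sum_congr rfl fun S _ => Equiv.sum_comp (Equiv.subLeft S)
            fun R => ((2 : ℝ) ^ (2 ^ Module.finrank (ZMod 2) (LinearMap.ker R) - 1) - 1)
      _ ≤ ∑ _S : E →ₗ[ZMod 2] F, Module.finrank (ZMod 2) E * ((2 : ℝ) ^ c)⁻¹
            * Fintype.card (E →ₗ[ZMod 2] F) :=
          Finset.sum_le_sum fun _ _ => sum_two_pow_ker_sub_one_le h
      _ = _ := by
          rw [Finset.sum_const, Finset.card_univ, nsmul_eq_mul]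
          ring

end LowerBound

/-! ### Choice of the dimension and the lower tail -/

/-- As 2^j / j is nondecreasing, control of 2^j at the extreme j = k gives it for all j. -/
theorem two_pow_mul_le_mul_two_pow {j k : ℕ} (hj : 1 ≤ j) (hjk : j ≤ k) :
    2 ^ j * k ≤ j * 2 ^ k := by
  induction k, hjk using Nat.le_induction with
  | base => exact (mul_comm _ _).le
  | succ k hk ih =>
    have h1 : 2 ^ j ≤ j * 2 ^ k :=
      (Nat.pow_le_pow_right two_pos hk).trans (Nat.le_mul_of_pos_left _ hj)
    rw [pow_succ]
    linarith

theorem subsetDensity_cliqueNum_lt_two_pow_le {n k c : ℕ} (hk : k ≤ n)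
    (h : ∀ j, 1 ≤ j → j ≤ k → 2 ^ j + k * j + c ≤ (n - k) * j) :
    subsetDensity (fun A : Finset (Fin n → ZMod 2) =>
        (cayleySumGraph (A : Set (Fin n → ZMod 2))).cliqueNum < 2 ^ k)
      ≤ k * ((2 : ℝ) ^ c)⁻¹ := by
  classical
  have hfin : Finite ((Fin k → ZMod 2) →ₗ[ZMod 2] (Fin (n - k) → ZMod 2)) := DFunLike.finite _
  have := Fintype.ofFinite ((Fin k → ZMod 2) →ₗ[ZMod 2] (Fin (n - k) → ZMod 2))
  let e : ((Fin k → ZMod 2) × (Fin (n - k) → ZMod 2)) ≃ₗ[ZMod 2] (Fin n → ZMod 2) :=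
    LinearEquiv.ofFinrankEq _ _ (by
      rw [Module.finrank_prod, Module.finrank_fin_fun, Module.finrank_fin_fun,
        Module.finrank_fin_fun, Nat.add_sub_cancel' hk])
  have key := subsetDensity_cliqueNum_lt_le_of_equiv (c := c) e (by
    simpa only [Module.finrank_fin_fun] using h)
  rw [Module.finrank_fin_fun, card_eq_two_pow_finrank, Module.finrank_fin_fun] at key
  exact key

theorem subsetDensity_cliqueNum_lt_le {n : ℕ} {l : ℝ} (hl : 100 ≤ l) (hn : 10 ^ 9 * l ^ 3 ≤ n)
    (hnl : Real.logb 2 n = l) (hlog : Real.logb 2 (309 * n * l) ≤ 1.01 * l) :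
    subsetDensity (fun A : Finset (Fin n → ZMod 2) =>
      ((cayleySumGraph (A : Set (Fin n → ZMod 2))).cliqueNum : ℝ) < 1 / 4 * n * l)
      ≤ 1 / n := by
  have hn1 : (10 : ℝ) ^ 5 * l ≤ n := by
    have : (100 : ℝ) ^ 2 ≤ l ^ 2 := by gcongr
    nlinarith
  have hn0 : (0 : ℝ) < n := by linarith
  have hpos : 0 < 1 / 4 * n * l := by positivity
  -- Rounding up loses at most a factor 2, so n·l/4 ≤ 2^k ≤ n·l/2; the upper value is what the
  -- second moment tolerates.
  obtain ⟨k, hk⟩ : ∃ k, k = ⌈Real.logb 2 (1 / 4 * n * l)⌉₊ := ⟨_, rfl⟩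
  have hge : l ≤ Real.logb 2 (1 / 4 * n * l) := by
    rw [← hnl]
    refine Real.logb_le_logb_of_le (by norm_num) hn0 ?_
    rw [hnl]
    nlinarith
  have hle : Real.logb 2 (1 / 4 * n * l) ≤ 1.01 * l :=
    (Real.logb_le_logb_of_le (by norm_num) hpos (by nlinarith)).trans hlog
  have hk1 : Real.logb 2 (1 / 4 * n * l) ≤ k := hk ▸ Nat.le_ceil _
  have hk2 : (k : ℝ) < Real.logb 2 (1 / 4 * n * l) + 1 :=
    hk ▸ Nat.ceil_lt_add_one (by linarith)
  have hpow1 : 1 / 4 * n * l ≤ (2 : ℝ) ^ k := by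
    rw [← Real.rpow_natCast, ← Real.logb_le_iff_le_rpow (by norm_num) hpos]
    exact hk1
  have hpow2 : (2 : ℝ) ^ k ≤ 1 / 2 * n * l := by
    rw [← Real.rpow_natCast, ← Real.le_logb_iff_rpow_le (by norm_num) (by positivity)]
    have : Real.logb 2 (1 / 2 * n * l) = Real.logb 2 (1 / 4 * n * l) + 1 := by
      rw [show 1 / 2 * (n : ℝ) * l = (1 / 4 * n * l) * 2 by ring,
        Real.logb_mul hpos.ne' (by norm_num), Real.logb_self_eq_one (by norm_num)]
    linarith
  have hkn : (8 : ℝ) * k ≤ n := by linarith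
  have hknN : 8 * k ≤ n := by exact_mod_cast hkn
  -- 2^j takes at most half of n·j, and the terms in `k` total at most 4kj ≤ nj/2. Taking c = 2k
  -- makes the failure probability k/4^k ≤ 1/n.
  have hcond : ∀ j, 1 ≤ j → j ≤ k → 2 ^ j + k * j + 2 * k ≤ (n - k) * j := by
    intro j hj hjk
    have h1 : (2 : ℝ) ^ j * k ≤ j * 2 ^ k := by exact_mod_cast two_pow_mul_le_mul_two_pow hj hjk
    have hjR : (1 : ℝ) ≤ j := by exact_mod_cast hj
    have h2 : (2 : ℝ) ^ j ≤ j * (n / 2) := by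
      have hl0 : 0 < l := by linarith
      refine le_of_mul_le_mul_right ?_ hl0
      calc (2 : ℝ) ^ j * l ≤ 2 ^ j * k := by gcongr; linarith
        _ ≤ j * 2 ^ k := h1
        _ ≤ j * (1 / 2 * n * l) := by gcongr
        _ = _ := by ring
    have h3 : (2 : ℝ) ^ j + k * j + 2 * k ≤ (n - k) * j := by nlinarith
    have h4 : ((2 ^ j + k * j + 2 * k : ℕ) : ℝ) ≤ ((n - k) * j : ℕ) := by
      rw [Nat.cast_mul, Nat.cast_sub (by omega)]
      push_cast
      exact h3
    exact_mod_cast h4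
  refine (subsetDensity_mono fun A hA => ?_).trans
    ((subsetDensity_cliqueNum_lt_two_pow_le (by omega) hcond).trans ?_)
  · have : ((cayleySumGraph (A : Set (Fin n → ZMod 2))).cliqueNum : ℝ) < 2 ^ k := hA.trans_le hpow1
    exact_mod_cast this
  · rw [← div_eq_mul_inv, div_le_div_iff₀ (by positivity) hn0, one_mul, mul_comm 2 k, pow_mul]
    have h1 : (k : ℝ) ≤ 2 ^ k := by exact_mod_cast (Nat.lt_two_pow_self (n := k)).le
    have h2 : (n : ℝ) ≤ 2 ^ k := by nlinarith
    rw [sq]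
    gcongr

theorem tendsto_subsetDensity_cliqueNum_lt :
    Tendsto (fun n : ℕ => subsetDensity (fun A : Finset (Fin n → ZMod 2) =>
      ((cayleySumGraph (A : Set (Fin n → ZMod 2))).cliqueNum : ℝ) < 1 / 4 * n * Real.logb 2 n))
      atTop (𝓝 0) := by
  refine squeeze_zero' (Eventually.of_forall fun n => subsetDensity_nonneg _) ?_
    (tendsto_one_div_atTop_nhds_zero_nat (𝕜 := ℝ))
  filter_upwards [eventually_logb_bounds] with n hn
  exact subsetDensity_cliqueNum_lt_le hn.1 hn.2.1 rfl hn.2.2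

/-! ### Combining the two tails -/

theorem theorem9 :
    Tendsto (fun n : ℕ => cayleySumProb (Fin n → ZMod 2) (fun G =>
        (1 / 4 : ℝ) * Real.logb 2 ((2 : ℝ) ^ n) * Real.logb 2 (Real.logb 2 ((2 : ℝ) ^ n))
            ≤ (G.cliqueNum : ℝ) ∧
          (G.cliqueNum : ℝ)
            ≤ 308 * Real.logb 2 ((2 : ℝ) ^ n) * Real.logb 2 (Real.logb 2 ((2 : ℝ) ^ n))))
      atTop (𝓝 1) ∧
    ∀ C : ℝ, Tendsto (fun n : ℕ => cayleySumProb (Fin n → ZMod 2) (fun G =>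
        (G.cliqueNum : ℝ) ≤ C * Real.logb 2 ((2 : ℝ) ^ n)))
      atTop (𝓝 0) := by
  have hN : ∀ n : ℕ, Real.logb 2 ((2 : ℝ) ^ n) = n := fun n => by
    rw [Real.logb_pow, Real.logb_self_eq_one (by norm_num), mul_one]
  simp only [hN, cayleySumProb_eq_ofReal]
  constructor
  · rw [← ENNReal.ofReal_one]
    refine ENNReal.tendsto_ofReal ?_
    have hlim := tendsto_const_nhds (x := (1 : ℝ)) (f := (atTop : Filter ℕ)) |>.sub
      (tendsto_subsetDensity_cliqueNum_lt.add tendsto_subsetDensity_cliqueNum_gt)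
    rw [add_zero, sub_zero] at hlim
    refine tendsto_of_tendsto_of_tendsto_of_le_of_le hlim tendsto_const_nhds (fun n => ?_)
      (fun n => ?_)
    · simp only
      have h1 := subsetDensity_add_not (fun A : Finset (Fin n → ZMod 2) =>
        1 / 4 * (n : ℝ) * Real.logb 2 n ≤ (cayleySumGraph (A : Set (Fin n → ZMod 2))).cliqueNum ∧
        ((cayleySumGraph (A : Set (Fin n → ZMod 2))).cliqueNum : ℝ) ≤ 308 * n * Real.logb 2 n)
      rw [sub_le_iff_le_add]
      refine h1.ge.trans (add_le_add le_rfl ((subsetDensity_mono fun A hA => ?_).trans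
        (subsetDensity_or_le _ _)))
      rwa [not_and_or, not_le, not_le] at hA
    · have h1 := subsetDensity_add_not (fun A : Finset (Fin n → ZMod 2) =>
        1 / 4 * (n : ℝ) * Real.logb 2 n ≤ (cayleySumGraph (A : Set (Fin n → ZMod 2))).cliqueNum ∧
        ((cayleySumGraph (A : Set (Fin n → ZMod 2))).cliqueNum : ℝ) ≤ 308 * n * Real.logb 2 n)
      exact (le_add_of_nonneg_right (subsetDensity_nonneg _)).trans_eq h1
  · intro C
    rw [← ENNReal.ofReal_zero]
    refine ENNReal.tendsto_ofReal ?_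
    refine squeeze_zero' (Eventually.of_forall fun n => subsetDensity_nonneg _) ?_
      tendsto_subsetDensity_cliqueNum_lt
    -- Once log₂ n > 4C, the bound C·n lies below n·log₂ n / 4, so the event falls in the lower
    -- tail.
    have hlog : Tendsto (fun n : ℕ => Real.logb 2 n) atTop atTop :=
      (Real.tendsto_logb_atTop (by norm_num)).comp tendsto_natCast_atTop_atTop
    filter_upwards [hlog.eventually_gt_atTop (4 * C), eventually_gt_atTop 0] with n hC hn
    refine subsetDensity_mono fun A hA => hA.trans_lt ?_
    have : (0 : ℝ) < n := by exact_mod_cast hn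
    nlinarith
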